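/- Let $p\ge 1$, let $P\in\mathbb{Q}[X_1,\dots,X_p]$, and let $n_1,\dots,n_p\ge 0$ and $A_1,\dots,A_p\ge 1$ be integers. Write $(\alpha)_m=\alpha(\alpha+1)\cdots(\alpha+m-1)$ for the Pochhammer symbol. Suppose that the multiple series $$\sum_{k_1\ge k_2\ge\cdots\ge k_p\ge 1}\frac{P(k_1,\dots,k_p)}{(k_1)_{n_1+1}^{A_1}\cdots(k_p)_{n_p+1}^{A_p}}$$ converges, in the sense that its partial sums over $N\ge k_1\ge\cdots\ge k_p\ge 1$ have a finite limit $S$ as $N\to\infty$ (in particular, this holds, with $S$ the sum of the series, whenever the series converges absolutely). Then $S$ is a linear combination with rational coefficients of convergent multiple zeta values $$\zeta(s_1,\dots,s_q)=\sum_{k_1>k_2>\cdots>k_q\ge 1}\frac{1}{k_1^{s_1}k_2^{s_2}\cdots k_q^{s_q}}$$ with $0\le q\le p$, integers $s_i\ge 1$ for $i=1,\dots,q$, $s_1\ge 2$ if $q\ge 1$, and weight $\sum_{j=1}^q s_j\le\sum_{j=1}^p A_j$; here the value of depth $q=0$ is equal to $1$. -/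

import Mathlib

open Filter Topology

noncomputable section

/-- The general term
`P(k₁, …, k_p) / ((k₁)_{n₁+1}^{A₁} ⋯ (k_p)_{n_p+1}^{A_p})` of the multiple series, where
`(α)_m = α (α + 1) ⋯ (α + m - 1)` is the Pochhammer symbol. -/
def hypergeomTerm {p : ℕ} (P : MvPolynomial (Fin p) ℚ) (n A : Fin p → ℕ) (k : Fin p → ℕ) : ℝ :=
  MvPolynomial.aeval (fun j => (k j : ℝ)) P /
    ∏ j, ((ascPochhammer ℝ (n j + 1)).eval (k j : ℝ)) ^ A j

open Classical in
/-- The finite set of the `k = (k₁, …, k_p)` with `N ≥ k₁ ≥ k₂ ≥ ⋯ ≥ k_p ≥ 1`. -/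
def chainsUpTo (p N : ℕ) : Finset (Fin p → ℕ) :=
  (Fintype.piFinset fun _ : Fin p => Finset.Icc 1 N).filter fun k => Antitone k

/-- The multiple series `∑_{k₁ ≥ ⋯ ≥ k_p ≥ 1} F(k₁, …, k_p)` converges, with sum `S`: its partial
sums over `N ≥ k₁ ≥ ⋯ ≥ k_p ≥ 1` tend to `S` as `N → ∞`. For a series that converges absolutely,
`S` is its unordered sum; absolute convergence is not required. -/
def HasMultipleSum {p : ℕ} (F : (Fin p → ℕ) → ℝ) (S : ℝ) : Prop :=
  Tendsto (fun N : ℕ => ∑ k ∈ chainsUpTo p N, F k) atTop (𝓝 S)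

/-- The multiple zeta value
`ζ(s₁, …, s_q) = ∑_{k₁ > k₂ > ⋯ > k_q ≥ 1} 1 / (k₁^{s₁} ⋯ k_q^{s_q})`
(equal to `1` for `q = 0`). -/
def multiZeta {q : ℕ} (s : Fin q → ℕ) : ℝ :=
  ∑' k : {k : Fin q → ℕ // StrictAnti k ∧ ∀ j, 1 ≤ k j}, ∏ j, 1 / ((k.1 j : ℝ) ^ s j)

/-- The `ℚ`-linear combinations of the convergent multiple zeta values `ζ(s₁, …, s_q)` of depth
`0 ≤ q ≤ p` and weight `s₁ + ⋯ + s_q ≤ w`, where all `sᵢ ≥ 1`, and `s₁ ≥ 2` when `q ≥ 1`. -/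
def multiZetaSpan (p w : ℕ) : Submodule ℚ ℝ :=
  Submodule.span ℚ {x : ℝ | ∃ q : ℕ, q ≤ p ∧ ∃ s : Fin q → ℕ,
    (∀ i, 1 ≤ s i) ∧ (∀ h : 0 < q, 2 ≤ s ⟨0, h⟩) ∧ ∑ i, s i ≤ w ∧ x = multiZeta s}

end

/-! Two independent facts give the theorem.

Finite level: as functions of the upper bound, the partial sums are rational combinations of
products of a rational function and a multiple harmonic sum, of depth at most `p` and total weight
at most the sum of the `A j` (`sum_hypergeomTerm_mem_mhsSpan`). One sums over one variable at a
time. Partial fractions reduce the summand to powers and simple poles times a multiple harmonic sum;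
summation by parts and index shifts then sum it, at the cost of one unit of depth and none of weight
(`psum_mem_mhsSpan`).

Asymptotic level: every multiple harmonic sum has an expansion in the functions `H_{N+1} ^ i * (N +
1) ^ j`, whose coefficients are combinations of convergent multiple zeta values of no larger depth
and weight (`mhs_mem_AsympExp`). If the first exponent is at least 2, summing an expansion termwise
leaves one new constant, the zeta value itself (`exists_tendsto_psum`). Leading ones are removed by
the stuffle product with the harmonic number (`mhs_one_mul_leadingOnes`), which produces powers of
`H_{N+1}`.

Thus the partial sums have such an expansion, possibly with growing terms. These functions are
totally ordered by growth, so if the partial sums converge, the limit is the coefficient of the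
constant function (`mem_of_tendsto_of_mem_AsympExp`). Absolute convergence plays no role. -/

noncomputable section

open Asymptotics

/-! ### Multiple harmonic sums and the logarithmic-polynomial scale -/

/-- The multiple harmonic sum `∑_{N ≥ k₁ > ⋯ > k_q ≥ 1} 1 / (k₁ ^ s₁ ⋯ k_q ^ s_q)`. -/
def mhs : List ℕ → ℕ → ℝ
  | [], _ => 1
  | a :: s, N => ∑ k ∈ Finset.range N, 1 / ((k : ℝ) + 1) ^ a * mhs s k

/-- The harmonic number `H_{N+1}`. -/
def harm (N : ℕ) : ℝ := mhs [1] (N + 1)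

lemma harm_eq_harmonic (N : ℕ) : harm N = (harmonic (N + 1) : ℝ) := by
  simp [harm, mhs, harmonic]

lemma harm_succ (N : ℕ) : harm (N + 1) = harm N + ((N : ℝ) + 2)⁻¹ := by
  simp only [harm_eq_harmonic, harmonic_succ (N + 1)]
  push_cast
  ring

lemma tendsto_harm : Tendsto harm atTop atTop := by
  have h : Tendsto (fun N : ℕ => Real.log ((N + 1 + 1 : ℕ) : ℝ)) atTop atTop :=
    Real.tendsto_log_atTop.comp (tendsto_natCast_atTop_atTop.comp
      ((tendsto_add_atTop_nat 1).comp (tendsto_add_atTop_nat 1)))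
  refine tendsto_atTop_mono (fun N => ?_) h
  rw [harm_eq_harmonic]
  exact log_add_one_le_harmonic _

lemma harm_pos (N : ℕ) : 0 < harm N := by
  rw [harm_eq_harmonic]
  exact_mod_cast harmonic_pos (Nat.succ_ne_zero N)

lemma tendsto_natCast_add_one : Tendsto (fun N : ℕ => (N : ℝ) + 1) atTop atTop :=
  tendsto_atTop_add_const_right _ _ tendsto_natCast_atTop_atTop

lemma harm_pow_isLittleO (i : ℕ) :
    (fun N => harm N ^ i) =o[atTop] fun N : ℕ => (N : ℝ) + 1 := by
  have h1 : harm =O[atTop] fun N : ℕ => Real.log ((N : ℝ) + 1) := by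
    -- The harmonic number is at most `1 + log`, hence at most `2 * log` once `log ≥ 1`.
    refine IsBigO.of_bound 2 ?_
    have := (Real.tendsto_log_atTop.comp tendsto_natCast_add_one).eventually_ge_atTop 1
    filter_upwards [this] with N hN
    simp only [Function.comp] at hN
    have h := harmonic_le_one_add_log (N + 1)
    rw [← harm_eq_harmonic] at h
    push_cast at h
    rw [Real.norm_of_nonneg (harm_pos N).le, Real.norm_of_nonneg (by linarith)]
    linarith
  exact (h1.pow i).trans_isLittleO
    ((Real.isLittleO_pow_log_id_atTop (n := i)).comp_tendsto tendsto_natCast_add_one)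

/-- The asymptotic scale `H_{N+1} ^ i * (N + 1) ^ j`. -/
def logMonomial (i : ℕ) (j : ℤ) (N : ℕ) : ℝ := harm N ^ i * ((N : ℝ) + 1) ^ j

lemma logMonomial_mul (i i' : ℕ) (j j' : ℤ) (N : ℕ) :
    logMonomial i j N * logMonomial i' j' N = logMonomial (i + i') (j + j') N := by
  have : (N : ℝ) + 1 ≠ 0 := by positivity
  simp only [logMonomial, pow_add, zpow_add₀ this]
  ring

lemma zpow_isBigO_zpow {j j' : ℤ} (h : j ≤ j') :
    (fun N : ℕ => ((N : ℝ) + 1) ^ j) =O[atTop] fun N : ℕ => ((N : ℝ) + 1) ^ j' := by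
  refine IsBigO.of_bound 1 (Eventually.of_forall fun N => ?_)
  rw [one_mul, Real.norm_of_nonneg (by positivity), Real.norm_of_nonneg (by positivity)]
  exact zpow_le_zpow_right₀ (by simp) h

lemma logMonomial_isLittleO_zpow (i : ℕ) {j j' : ℤ} (h : j < j') :
    logMonomial i j =o[atTop] fun N : ℕ => ((N : ℝ) + 1) ^ j' := by
  have h1 := (harm_pow_isLittleO i).mul_isBigO (zpow_isBigO_zpow (show j ≤ j' - 1 by omega))
  refine h1.congr (fun N => rfl) (fun N => ?_)
  have : (N : ℝ) + 1 ≠ 0 := by positivity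
  rw [← zpow_one_add₀ this]
  congr 1
  ring

lemma logMonomial_isLittleO {i i' : ℕ} {j j' : ℤ} (h : j < j' ∨ j = j' ∧ i < i') :
    logMonomial i j =o[atTop] logMonomial i' j' := by
  rcases h with h | ⟨rfl, h⟩
  · refine (logMonomial_isLittleO_zpow i h).trans_isBigO ?_
    refine IsBigO.of_bound 1 ?_
    filter_upwards [tendsto_harm.eventually_ge_atTop 1] with N hN
    rw [one_mul, logMonomial, norm_mul]
    refine le_mul_of_one_le_left (norm_nonneg _) ?_
    rw [Real.norm_of_nonneg (by positivity)]
    exact one_le_pow₀ hN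
  · exact ((isLittleO_pow_pow_atTop_of_lt h).comp_tendsto tendsto_harm).mul_isBigO
      (isBigO_refl _ _)

/-! ### Algebra of asymptotic expansions -/

/-- The combinations of the `H_{N+1} ^ i * (N + 1) ^ j` with `j ≤ d` and coefficients in `Z`. -/
def logMonomialSpan (Z : Submodule ℚ ℝ) (d : ℤ) : Submodule ℚ (ℕ → ℝ) :=
  Submodule.span ℚ {f | ∃ c ∈ Z, ∃ (i : ℕ) (j : ℤ), j ≤ d ∧ f = fun N => c * logMonomial i j N}

lemma logMonomialSpan_mono {Z Z' : Submodule ℚ ℝ} {d d' : ℤ} (hZ : Z ≤ Z') (hd : d ≤ d') :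
    logMonomialSpan Z d ≤ logMonomialSpan Z' d' :=
  Submodule.span_mono fun _ ⟨c, hc, i, j, hj, hf⟩ => ⟨c, hZ hc, i, j, hj.trans hd, hf⟩

lemma logMonomialSpan_isBigO {Z : Submodule ℚ ℝ} {d : ℤ} {f : ℕ → ℝ}
    (hf : f ∈ logMonomialSpan Z d) :
    f =O[atTop] fun N : ℕ => ((N : ℝ) + 1) ^ (d + 1) := by
  induction hf using Submodule.span_induction with
  | mem f hf =>
    obtain ⟨c, -, i, j, hj, rfl⟩ := hf
    exact (logMonomial_isLittleO_zpow i (by omega)).isBigO.const_mul_left c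
  | zero => exact isBigO_zero _ _
  | add f g _ _ hf hg => exact hf.add hg
  | smul q f _ hf =>
    refine (hf.const_mul_left (q : ℝ)).congr_left fun N => ?_
    simp [Rat.smul_def]

/-- Only one factor may have coefficients in `Z`; the other has rational ones. `Z` is not assumed
closed under products, which for zeta values would raise depth and weight. -/
lemma logMonomialSpan_mul {Z : Submodule ℚ ℝ} {d d' : ℤ} {f g : ℕ → ℝ}
    (hf : f ∈ logMonomialSpan Z d) (hg : g ∈ logMonomialSpan 1 d') :
    f * g ∈ logMonomialSpan Z (d + d') := by
  induction hf using Submodule.span_induction with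
  | mem f hf =>
    obtain ⟨c, hc, i, j, hj, rfl⟩ := hf
    induction hg using Submodule.span_induction with
    | mem g hg =>
      obtain ⟨c', hc', i', j', hj', rfl⟩ := hg
      obtain ⟨q, rfl⟩ := Submodule.mem_one.1 hc'
      refine Submodule.subset_span ⟨q • c, Z.smul_mem q hc, i + i', j + j', by omega, ?_⟩
      ext N
      simp only [Pi.mul_apply, ← logMonomial_mul, eq_ratCast, Rat.smul_def]
      ring
    | zero => simp
    | add g g' _ _ hg hg' => rw [mul_add]; exact add_mem hg hg'
    | smul q g _ hg => rw [mul_smul_comm]; exact Submodule.smul_mem _ _ hg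
  | zero => simp
  | add f f' _ _ hf hf' => rw [add_mul]; exact add_mem hf hf'
  | smul q f _ hf => rw [smul_mul_assoc]; exact Submodule.smul_mem _ _ hf

lemma logMonomial_mem (i : ℕ) {j d : ℤ} (h : j ≤ d) : logMonomial i j ∈ logMonomialSpan 1 d :=
  Submodule.subset_span ⟨1, Submodule.one_le.1 le_rfl, i, j, h, by simp⟩

lemma const_mem_logMonomialSpan {Z : Submodule ℚ ℝ} {c : ℝ} (hc : c ∈ Z) :
    (fun _ => c) ∈ logMonomialSpan Z 0 :=
  Submodule.subset_span ⟨c, hc, 0, 0, le_rfl, by simp [logMonomial]⟩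

/-- The sequences with an asymptotic expansion in the `H_{N+1} ^ i * (N + 1) ^ j`, `j ≤ d`, to any
order, with coefficients in `Z`. -/
def AsympExp (Z : Submodule ℚ ℝ) (d : ℤ) : Submodule ℚ (ℕ → ℝ) where
  carrier := {f | ∀ M : ℕ, ∃ g ∈ logMonomialSpan Z d,
    (f - g) =O[atTop] fun N : ℕ => ((N : ℝ) + 1) ^ (-(M : ℤ))}
  zero_mem' M := ⟨0, zero_mem _, by rw [sub_zero]; exact isBigO_zero _ _⟩
  add_mem' {f f'} hf hf' M := by
    obtain ⟨g, hg, h⟩ := hf M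
    obtain ⟨g', hg', h'⟩ := hf' M
    exact ⟨g + g', add_mem hg hg', by rw [add_sub_add_comm]; exact h.add h'⟩
  smul_mem' q f hf M := by
    obtain ⟨g, hg, h⟩ := hf M
    refine ⟨q • g, Submodule.smul_mem _ _ hg, ?_⟩
    refine (h.const_mul_left (q : ℝ)).congr_left fun N => ?_
    simp [Rat.smul_def, mul_sub]

lemma mem_AsympExp {Z : Submodule ℚ ℝ} {d : ℤ} {f : ℕ → ℝ} : f ∈ AsympExp Z d ↔
    ∀ M : ℕ, ∃ g ∈ logMonomialSpan Z d,
      (f - g) =O[atTop] fun N : ℕ => ((N : ℝ) + 1) ^ (-(M : ℤ)) := Iff.rfl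

lemma AsympExp_mono {Z Z' : Submodule ℚ ℝ} {d d' : ℤ} (hZ : Z ≤ Z') (hd : d ≤ d') :
    AsympExp Z d ≤ AsympExp Z' d' := fun _ hf M =>
  let ⟨g, hg, h⟩ := mem_AsympExp.1 hf M
  ⟨g, logMonomialSpan_mono hZ hd hg, h⟩

lemma logMonomialSpan_le_AsympExp (Z : Submodule ℚ ℝ) (d : ℤ) :
    logMonomialSpan Z d ≤ AsympExp Z d := fun _f hf _ =>
  ⟨_, hf, by rw [sub_self]; exact isBigO_zero _ _⟩

lemma AsympExp_congr {Z : Submodule ℚ ℝ} {d : ℤ} {f g : ℕ → ℝ} (hf : f ∈ AsympExp Z d)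
    (h : f =ᶠ[atTop] g) : g ∈ AsympExp Z d := fun M => by
  obtain ⟨f', hf', hM⟩ := mem_AsympExp.1 hf M
  exact ⟨f', hf', hM.congr' (h.sub (EventuallyEq.refl _ _)) (EventuallyEq.refl _ _)⟩

lemma AsympExp_isBigO {Z : Submodule ℚ ℝ} {d : ℤ} {f : ℕ → ℝ} (hf : f ∈ AsympExp Z d) :
    f =O[atTop] fun N : ℕ => ((N : ℝ) + 1) ^ (d + 1) := by
  obtain ⟨g, hg, h⟩ := mem_AsympExp.1 hf (d + 1).natAbs
  have := (h.trans (zpow_isBigO_zpow (by omega))).add (logMonomialSpan_isBigO hg)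
  simpa using this

lemma AsympExp_mul {Z : Submodule ℚ ℝ} {d d' : ℤ} {f g : ℕ → ℝ}
    (hf : f ∈ AsympExp Z d) (hg : g ∈ AsympExp 1 d') : f * g ∈ AsympExp Z (d + d') := fun M => by
  -- Each factor is expanded beyond order `M` by enough to absorb the growth of the other.
  obtain ⟨f', hf', h⟩ := mem_AsympExp.1 hf (M + (d' + 1).natAbs)
  obtain ⟨g', hg', h'⟩ := mem_AsympExp.1 hg (M + (d + 1).natAbs)
  refine ⟨f' * g', logMonomialSpan_mul hf' hg', ?_⟩
  have e : f * g - f' * g' = (f - f') * g + f' * (g - g') := by ring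
  rw [e]
  have aux : ∀ (u v : ℕ → ℝ) (a b : ℤ), u =O[atTop] (fun N : ℕ => ((N : ℝ) + 1) ^ a) →
      v =O[atTop] (fun N : ℕ => ((N : ℝ) + 1) ^ b) → a + b ≤ -(M : ℤ) →
      (u * v) =O[atTop] fun N : ℕ => ((N : ℝ) + 1) ^ (-(M : ℤ)) := by
    intro u v a b hu hv hab
    refine ((hu.mul hv).congr_right fun N => ?_).trans (zpow_isBigO_zpow hab)
    rw [zpow_add₀ (by positivity)]
  exact (aux _ _ _ _ h (AsympExp_isBigO hg) (by rw [Nat.cast_add]; omega)).add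
    (aux _ _ _ _ (logMonomialSpan_isBigO hf') h' (by rw [Nat.cast_add]; omega))

lemma const_mem_AsympExp {Z : Submodule ℚ ℝ} {c : ℝ} (hc : c ∈ Z) :
    (fun _ => c) ∈ AsympExp Z 0 :=
  logMonomialSpan_le_AsympExp _ _ (const_mem_logMonomialSpan hc)

lemma logMonomial_mem_AsympExp (i : ℕ) {j d : ℤ} (h : j ≤ d) : logMonomial i j ∈ AsympExp 1 d :=
  logMonomialSpan_le_AsympExp _ _ (logMonomial_mem i h)

lemma one_mem_AsympExp : (1 : ℕ → ℝ) ∈ AsympExp 1 0 :=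
  const_mem_AsympExp (Submodule.one_le.1 le_rfl)

lemma AsympExp_pow {d : ℤ} {f : ℕ → ℝ} (hf : f ∈ AsympExp 1 d) (n : ℕ) :
    f ^ n ∈ AsympExp 1 (n * d) := by
  induction n with
  | zero => simpa using one_mem_AsympExp
  | succ n ih =>
    rw [pow_succ]
    convert AsympExp_mul ih hf using 2
    push_cast
    ring

/-- A sequence `f` with `f(N) = g(N) + r(N) f(N)`, `r = O(1/N)`, inherits expansions from `g`, `r`. -/
lemma AsympExp_of_eventually_eq_add_mul {f g r : ℕ → ℝ} {d : ℤ} (hg : g ∈ AsympExp 1 d)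
    (hr : r ∈ AsympExp 1 (-1)) (hrO : r =O[atTop] fun N : ℕ => ((N : ℝ) + 1) ^ (-1 : ℤ))
    (hfO : ∃ m : ℕ, f =O[atTop] fun N : ℕ => ((N : ℝ) + 1) ^ (m : ℤ))
    (h : f =ᶠ[atTop] g + r * f) : f ∈ AsympExp 1 d := fun M => by
  obtain ⟨m, hm⟩ := hfO
  -- Iteration of `u ↦ g + u * r`, from `u = 0`: the error is multiplied by `r`, so each round gains
  -- a factor `1 / N`.
  have key : ∀ n : ℕ, ∃ u ∈ AsympExp 1 d,
      (f - u) =O[atTop] fun N : ℕ => ((N : ℝ) + 1) ^ ((m : ℤ) - n) := by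
    intro n
    induction n with
    | zero => exact ⟨0, zero_mem _, by simpa using hm⟩
    | succ n ih =>
      obtain ⟨u, hu, hO⟩ := ih
      refine ⟨g + u * r, add_mem hg (AsympExp_mono le_rfl (by omega) (AsympExp_mul hu hr)), ?_⟩
      refine (hrO.mul hO).congr' ?_ (Eventually.of_forall fun N => ?_)
      · filter_upwards [h] with N hN
        simp only [Pi.sub_apply, Pi.add_apply, Pi.mul_apply] at hN ⊢
        nth_rw 2 [hN]
        ring
      · dsimp only
        rw [← zpow_add₀ (by positivity)]
        congr 1
        push_cast
        ring
  obtain ⟨u, hu, hO⟩ := key (m + M)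
  obtain ⟨g', hg', hO'⟩ := mem_AsympExp.1 hu M
  refine ⟨g', hg', ?_⟩
  have := (hO.trans (zpow_isBigO_zpow (j' := -(M : ℤ)) (by push_cast; omega))).add hO'
  exact this.congr_left fun N => by simp

lemma inv_mem_AsympExp (i : ℕ) : (fun N : ℕ => 1 / ((N : ℝ) + 1 + i)) ∈ AsympExp 1 (-1) := by
  have h1 : (fun N : ℕ => ((N : ℝ) + 1) ^ (-1 : ℤ)) ∈ AsympExp 1 (-1) := by
    convert logMonomial_mem_AsympExp 0 (le_refl (-1)) using 2 with N
    rw [logMonomial, pow_zero, one_mul]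
  refine AsympExp_of_eventually_eq_add_mul (r := (-(i : ℚ)) • fun N : ℕ => ((N : ℝ) + 1) ^ (-1 : ℤ))
    h1 (Submodule.smul_mem _ _ h1) ?_ ⟨0, ?_⟩ (Eventually.of_forall fun N => ?_)
  · refine ((isBigO_refl _ _).const_mul_left (-(i : ℝ))).congr_left fun N => ?_
    simp [Rat.smul_def]
  · refine IsBigO.of_bound 1 (Eventually.of_forall fun N => ?_)
    rw [Real.norm_of_nonneg (by positivity)]
    simp only [Nat.cast_zero, zpow_zero, norm_one, mul_one]
    rw [div_le_one (by positivity)]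
    have : (0 : ℝ) ≤ N := by positivity
    have : (0 : ℝ) ≤ i := by positivity
    linarith
  · have : (N : ℝ) + 1 ≠ 0 := by positivity
    have : (N : ℝ) + 1 + i ≠ 0 := by positivity
    simp only [Pi.add_apply, Pi.mul_apply, Pi.smul_apply, Rat.smul_def]
    push_cast
    simp only [zpow_neg, zpow_one]
    field_simp
    ring

/-! ### Summation of asymptotic expansions -/

/-- The backward difference `N ↦ f N - f (N - 1)`. -/
def backDiff : (ℕ → ℝ) →ₗ[ℚ] (ℕ → ℝ) where
  toFun f N := f N - f (N - 1)
  map_add' f g := by ext N; simp only [Pi.add_apply]; ring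
  map_smul' q f := by ext N; simp [Rat.smul_def, mul_sub]

/-- The partial sums `N ↦ f 0 + ⋯ + f N`. -/
def psum : (ℕ → ℝ) →ₗ[ℚ] (ℕ → ℝ) where
  toFun f N := ∑ k ∈ Finset.range (N + 1), f k
  map_add' f g := by ext N; simp [Finset.sum_add_distrib]
  map_smul' q f := by ext N; simp [Finset.smul_sum]

lemma psum_apply (f : ℕ → ℝ) (N : ℕ) : psum f N = ∑ k ∈ Finset.range (N + 1), f k := rfl

/-- Truncated subtraction makes `backDiff f 0` vanish, which is why `f 0` is left over. -/
lemma psum_backDiff (f : ℕ → ℝ) (N : ℕ) : psum (backDiff f) N = f N - f 0 := by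
  rw [psum_apply]
  induction N with
  | zero => simp [backDiff]
  | succ N ih => rw [Finset.sum_range_succ, ih]; simp [backDiff]

lemma zpow_mem_AsympExp (j : ℤ) : (fun N : ℕ => ((N : ℝ) + 1) ^ j) ∈ AsympExp 1 j := by
  convert logMonomial_mem_AsympExp 0 (le_refl j) using 2 with N
  rw [logMonomial, pow_zero, one_mul]

lemma harm_mem_AsympExp : harm ∈ AsympExp 1 0 := by
  have h : logMonomial 1 0 = harm := by ext N; simp [logMonomial]
  exact h ▸ logMonomial_mem_AsympExp 1 le_rfl

lemma cast_pred_add_one {N : ℕ} (hN : 1 ≤ N) : (((N - 1 : ℕ) : ℝ) + 1) = N := by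
  rw [Nat.cast_sub hN]; simp

lemma ratio_mem_AsympExp :
    (fun N : ℕ => ((N : ℝ) + 1) / (((N - 1 : ℕ) : ℝ) + 1)) ∈ AsympExp 1 0 := by
  refine AsympExp_of_eventually_eq_add_mul (r := fun N : ℕ => ((N : ℝ) + 1) ^ (-1 : ℤ))
    one_mem_AsympExp (zpow_mem_AsympExp _) (isBigO_refl _ _) ⟨0, ?_⟩ ?_
  · refine IsBigO.of_bound 2 ?_
    filter_upwards [eventually_ge_atTop 1] with N hN
    rw [cast_pred_add_one hN, Real.norm_of_nonneg (by positivity)]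
    have : (1 : ℝ) ≤ N := by exact_mod_cast hN
    simp only [Nat.cast_zero, zpow_zero, norm_one, mul_one]
    rw [div_le_iff₀ (by positivity)]
    linarith
  · filter_upwards [eventually_ge_atTop 1] with N hN
    simp only [Pi.add_apply, Pi.mul_apply, Pi.one_apply, cast_pred_add_one hN, zpow_neg_one]
    have : (N : ℝ) ≠ 0 := by positivity
    field_simp

/-- First-order expansion of `(1 - u) ^ (-n)` at `u = 1 / (N + 1)`; the induction rests on `w = 1 +
u + u ^ 2 * w` for `w = 1 / (1 - u)`. -/
lemma ratio_pow_mem_AsympExp (n : ℕ) :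
    (fun N : ℕ => (((N : ℝ) + 1) / (((N - 1 : ℕ) : ℝ) + 1)) ^ n - 1 - n * ((N : ℝ) + 1) ^ (-1 : ℤ))
      ∈ AsympExp 1 (-2) := by
  set w : ℕ → ℝ := fun N => ((N : ℝ) + 1) / (((N - 1 : ℕ) : ℝ) + 1) with hw
  have hwm : w ∈ AsympExp 1 0 := ratio_mem_AsympExp
  set u : ℕ → ℝ := fun N => ((N : ℝ) + 1) ^ (-1 : ℤ) with hu
  have hum : u ∈ AsympExp 1 (-1) := zpow_mem_AsympExp _
  have hum2 : u ^ 2 ∈ AsympExp 1 (-2) := AsympExp_pow hum 2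
  have hwu : ∀ᶠ N in atTop, w N = 1 + u N + u N ^ 2 * w N := by
    filter_upwards [eventually_ge_atTop 1] with N hN
    simp only [hw, hu, cast_pred_add_one hN, zpow_neg_one]
    have : (N : ℝ) ≠ 0 := by positivity
    field_simp
    ring
  have goal : (fun N => w N ^ n - 1 - n * u N) ∈ AsympExp 1 (-2) := by
    induction n with
    | zero =>
      convert zero_mem (AsympExp 1 (-2))
      simp
    | succ n ih =>
      have h1 := AsympExp_mul ih hwm
      have h2 := AsympExp_mul hum2 hwm
      have h3 := AsympExp_mono le_rfl (show (-2 + -1 : ℤ) ≤ -2 by norm_num)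
        (AsympExp_mul hum2 hum)
      have h4 := AsympExp_mul (AsympExp_mono le_rfl (show (-2 + -1 : ℤ) ≤ -2 by norm_num)
        (AsympExp_mul hum2 hum)) hwm
      refine AsympExp_congr (add_mem (add_mem h1 h2)
        (add_mem (Submodule.smul_mem _ (n : ℚ) hum2) (Submodule.smul_mem _ (n : ℚ) h4))) ?_
      filter_upwards [hwu] with N hN
      simp only [Pi.add_apply, Pi.mul_apply, Pi.smul_apply, Pi.pow_apply, Rat.smul_def]
      push_cast
      linear_combination (-(1 + n * u N)) * hN
  exact goal

lemma harm_sub_pow_mem_AsympExp (i : ℕ) :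
    (fun N : ℕ => (harm N - ((N : ℝ) + 1) ^ (-1 : ℤ)) ^ i - harm N ^ i
      + i * harm N ^ (i - 1) * ((N : ℝ) + 1) ^ (-1 : ℤ)) ∈ AsympExp 1 (-2) := by
  set u : ℕ → ℝ := fun N => ((N : ℝ) + 1) ^ (-1 : ℤ) with hu
  have hum : u ∈ AsympExp 1 (-1) := zpow_mem_AsympExp _
  have hum2 : u ^ 2 ∈ AsympExp 1 (-2) := AsympExp_pow hum 2
  have goal : (fun N => (harm N - u N) ^ i - harm N ^ i + i * harm N ^ (i - 1) * u N)
      ∈ AsympExp 1 (-2) := by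
    induction i with
    | zero =>
      convert zero_mem (AsympExp 1 (-2))
      simp
    | succ i ih =>
      have h1 := AsympExp_mul ih
        (sub_mem harm_mem_AsympExp (AsympExp_mono le_rfl (by norm_num) hum))
      have h2 := AsympExp_mul hum2 (AsympExp_pow harm_mem_AsympExp (i - 1))
      rw [mul_zero] at h2
      refine AsympExp_congr (add_mem h1 (Submodule.smul_mem _ (i : ℚ) h2))
        (Eventually.of_forall fun N => ?_)
      simp only [Pi.add_apply, Pi.mul_apply, Pi.sub_apply, Pi.smul_apply, Pi.pow_apply,
        Rat.smul_def]
      rcases i with _ | i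
      · simp
      · simp only [Nat.add_sub_cancel]
        push_cast
        ring
  exact goal

/-- Discrete form of the derivative of `(log x) ^ i * x ^ (-n)`, up to two orders lower. The
truncated `i - 1` is harmless, since its factor `i` vanishes at `i = 0`. -/
lemma backDiff_logMonomial (i n : ℕ) :
    backDiff (logMonomial i (-n)) + (n : ℚ) • logMonomial i (-n - 1)
      - (i : ℚ) • logMonomial (i - 1) (-n - 1) ∈ AsympExp 1 (-n - 2) := by
  have hu := zpow_mem_AsympExp (-1)
  have hn := zpow_mem_AsympExp (-n)
  have hh := AsympExp_pow harm_mem_AsympExp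
  have e := harm_sub_pow_mem_AsympExp i
  have e' := ratio_pow_mem_AsympExp n
  have hw := AsympExp_pow ratio_mem_AsympExp n
  have t1 := AsympExp_mul hn (AsympExp_mul e hw)
  have t2 := AsympExp_mul hn (AsympExp_mul e' (hh i))
  have t3 := AsympExp_mul hn (AsympExp_mono le_rfl (show _ ≤ (-2 : ℤ) by simp)
    (AsympExp_mul (AsympExp_mul hu e') (hh (i - 1))))
  have t4 := AsympExp_mul hn (AsympExp_mul (AsympExp_mul hu hu) (hh (i - 1)))
  simp only [mul_zero, add_zero] at t1 t2 t3 t4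
  -- These are the second-order terms in the product of the expansions of `(H - u) ^ i` and of the
  -- ratio to the power `n`, which together give the value at `N - 1`.
  have key := add_mem (add_mem t1 t2) (sub_mem (Submodule.smul_mem _ (-(i : ℚ)) t3)
    (Submodule.smul_mem _ ((i : ℚ) * n) t4))
  refine AsympExp_congr (Submodule.smul_mem _ (-1) key) ?_
  filter_upwards [eventually_ge_atTop 1] with N hN
  have h0 : (N : ℝ) + 1 ≠ 0 := by positivity
  have h1 : (N : ℝ) ≠ 0 := by positivity
  have hharm : harm (N - 1) = harm N - ((N : ℝ) + 1) ^ (-1 : ℤ) := by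
    obtain ⟨m, rfl⟩ : ∃ m, N = m + 1 := ⟨N - 1, by omega⟩
    rw [Nat.add_sub_cancel, harm_succ, zpow_neg_one]
    push_cast
    ring
  have hpow : (((N - 1 : ℕ) : ℝ) + 1) ^ (-(n : ℤ)) =
      ((N : ℝ) + 1) ^ (-(n : ℤ)) * (((N : ℝ) + 1) / (((N - 1 : ℕ) : ℝ) + 1)) ^ n := by
    rw [cast_pred_add_one hN, zpow_neg, zpow_neg, zpow_natCast, zpow_natCast, div_pow]
    field_simp
  simp only [backDiff, LinearMap.coe_mk, AddHom.coe_mk, Pi.add_apply, Pi.mul_apply, Pi.sub_apply,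
    Pi.smul_apply, Pi.pow_apply, Rat.smul_def, logMonomial, hharm, hpow]
  rw [sub_eq_add_neg (-(n : ℤ)) 1, zpow_add₀ h0]
  push_cast
  ring

lemma exists_antideriv_of_logMonomial {Z : Submodule ℚ ℝ} {d : ℤ} {M : ℕ}
    (H : ∀ (i : ℕ) (j : ℤ), j ≤ d → ∃ F ∈ logMonomialSpan 1 (j + 1),
      (logMonomial i j - backDiff F) =O[atTop] fun N : ℕ => ((N : ℝ) + 1) ^ (-(M : ℤ)))
    {g : ℕ → ℝ} (hg : g ∈ logMonomialSpan Z d) :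
    ∃ F ∈ logMonomialSpan Z (d + 1),
      (g - backDiff F) =O[atTop] fun N : ℕ => ((N : ℝ) + 1) ^ (-(M : ℤ)) := by
  induction hg using Submodule.span_induction with
  | mem g hg =>
    obtain ⟨c, hc, i, j, hj, rfl⟩ := hg
    obtain ⟨F, hF, hO⟩ := H i j hj
    refine ⟨(fun _ => c) * F, logMonomialSpan_mono le_rfl (by omega)
      (logMonomialSpan_mul (const_mem_logMonomialSpan hc) hF), ?_⟩
    refine (hO.const_mul_left c).congr_left fun N => ?_
    simp only [backDiff, LinearMap.coe_mk, AddHom.coe_mk, Pi.mul_apply, Pi.sub_apply]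
    ring
  | zero => exact ⟨0, zero_mem _, by rw [map_zero, sub_zero]; exact isBigO_zero _ _⟩
  | add f g _ _ hf hg =>
    obtain ⟨F, hF, hO⟩ := hf
    obtain ⟨G, hG, hO'⟩ := hg
    exact ⟨F + G, add_mem hF hG, by rw [map_add, add_sub_add_comm]; exact hO.add hO'⟩
  | smul q f _ hf =>
    obtain ⟨F, hF, hO⟩ := hf
    refine ⟨q • F, Submodule.smul_mem _ _ hF, ?_⟩
    rw [map_smul, ← smul_sub]
    refine (hO.const_mul_left (q : ℝ)).congr_left fun N => ?_
    simp [Rat.smul_def]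

/-- `backDiff_logMonomial` is solved for the term with factor `n`, which needs `n ≥ 1`. What remains
has a smaller power of `H` (induction on `i`) or a lower degree (induction on `t`, the number of
orders still missing to reach precision `M`). -/
lemma exists_antideriv_logMonomial (M t : ℕ) : ∀ n : ℕ, 1 ≤ n → M ≤ n + t → ∀ i : ℕ,
    ∃ F ∈ logMonomialSpan 1 (-n), (logMonomial i (-n - 1) - backDiff F) =O[atTop]
      fun N : ℕ => ((N : ℝ) + 1) ^ (-(M : ℤ)) := by
  induction t with
  | zero =>
    intro n _ hM i
    refine ⟨0, zero_mem _, ?_⟩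
    rw [map_zero, sub_zero]
    exact (logMonomial_isLittleO_zpow i (by omega)).isBigO
  | succ t ih =>
    intro n hn hM i
    have lower : ∀ g ∈ logMonomialSpan 1 (-(n : ℤ) - 2), ∃ F ∈ logMonomialSpan 1 (-(n : ℤ) - 2 + 1),
        (g - backDiff F) =O[atTop] fun N : ℕ => ((N : ℝ) + 1) ^ (-(M : ℤ)) := by
      intro g hg
      refine exists_antideriv_of_logMonomial (fun i j hj => ?_) hg
      obtain ⟨F, hF, hO⟩ := ih (-j - 1).toNat (by omega) (by omega) i
      have h1 : -((-j - 1).toNat : ℤ) = j + 1 := by omega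
      rw [h1] at hF hO
      rw [add_sub_cancel_right] at hO
      exact ⟨F, hF, hO⟩
    have step : ∀ i : ℕ, (∃ F ∈ logMonomialSpan 1 (-n), ((i : ℚ) • logMonomial (i - 1) (-n - 1)
        - backDiff F) =O[atTop] fun N : ℕ => ((N : ℝ) + 1) ^ (-(M : ℤ))) →
        ∃ F ∈ logMonomialSpan 1 (-n), (logMonomial i (-n - 1) - backDiff F) =O[atTop]
          fun N : ℕ => ((N : ℝ) + 1) ^ (-(M : ℤ)) := by
      rintro i ⟨F, hF, hO⟩
      obtain ⟨g, hg, hgO⟩ := mem_AsympExp.1 (backDiff_logMonomial i n) M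
      obtain ⟨G, hG, hGO⟩ := lower g hg
      refine ⟨(n : ℚ)⁻¹ • (F + G - logMonomial i (-n)), Submodule.smul_mem _ _ (sub_mem (add_mem hF
        (logMonomialSpan_mono le_rfl (by omega) hG)) (logMonomial_mem i le_rfl)), ?_⟩
      refine (((hO.add hgO).add hGO).const_mul_left (n : ℝ)⁻¹).congr_left fun N => ?_
      have : (n : ℝ) ≠ 0 := by positivity
      simp only [map_smul, map_add, map_sub, Pi.add_apply, Pi.sub_apply, Pi.smul_apply,
        Rat.smul_def]
      push_cast
      field_simp
      ring
    induction i with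
    | zero =>
      refine step 0 ⟨0, zero_mem _, ?_⟩
      rw [map_zero, sub_zero, Nat.cast_zero, zero_smul]
      exact isBigO_zero _ _
    | succ i hi =>
      obtain ⟨F, hF, hO⟩ := hi
      refine step (i + 1) ⟨((i + 1 : ℕ) : ℚ) • F, Submodule.smul_mem _ _ hF, ?_⟩
      rw [map_smul, ← smul_sub]
      refine (hO.const_mul_left ((i + 1 : ℕ) : ℝ)).congr_left fun N => ?_
      simp [Rat.smul_def]

lemma exists_antideriv {Z : Submodule ℚ ℝ} {d : ℤ} (hd : d ≤ -2) (M : ℕ) {g : ℕ → ℝ}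
    (hg : g ∈ logMonomialSpan Z d) : ∃ F ∈ logMonomialSpan Z (d + 1),
      (g - backDiff F) =O[atTop] fun N : ℕ => ((N : ℝ) + 1) ^ (-(M : ℤ)) := by
  refine exists_antideriv_of_logMonomial (fun i j hj => ?_) hg
  obtain ⟨F, hF, hO⟩ := exists_antideriv_logMonomial M M (-j - 1).toNat (by omega) (by omega) i
  have h1 : -((-j - 1).toNat : ℤ) = j + 1 := by omega
  rw [h1] at hF hO
  rw [add_sub_cancel_right] at hO
  exact ⟨F, hF, hO⟩

/-- The constant is the sum of the series. In the tail, `(N + 1) ^ (-M)` factors out and the two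
spare powers ensure summability. -/
lemma psum_sub_const_isBigO {e : ℕ → ℝ} {M : ℕ}
    (he : e =O[atTop] fun N : ℕ => ((N : ℝ) + 1) ^ (-((M + 2 : ℕ) : ℤ))) :
    ∃ C : ℝ, (psum e - fun _ => C) =O[atTop] fun N : ℕ => ((N : ℝ) + 1) ^ (-(M : ℤ)) := by
  rw [isBigO_nat_atTop_iff (fun N h => absurd h (by positivity))] at he
  obtain ⟨C, hC⟩ := he
  set b : ℕ → ℝ := fun N => ((N : ℝ) + 1) ^ (-2 : ℤ) with hb
  have hbs : Summable b := by
    have := (summable_nat_add_iff 1).2 (Real.summable_one_div_nat_pow.2 (le_refl 2))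
    refine this.congr fun N => ?_
    simp [hb, zpow_neg]
  have hle : ∀ N k : ℕ, ‖e (k + (N + 1))‖ ≤ C * ((N : ℝ) + 1) ^ (-(M : ℤ)) * b (k + (N + 1)) := by
    intro N k
    refine (hC _).trans ?_
    have hC0 : 0 ≤ C := by
      have := (norm_nonneg _).trans (hC 0)
      simpa using this
    rw [mul_assoc]
    refine mul_le_mul_of_nonneg_left ?_ hC0
    rw [Real.norm_of_nonneg (by positivity), Nat.cast_add M, neg_add,
      zpow_add₀ (by positivity : ((k + (N + 1) : ℕ) : ℝ) + 1 ≠ 0)]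
    refine mul_le_mul_of_nonneg_right ?_ (by positivity)
    rw [zpow_neg, zpow_neg, zpow_natCast, zpow_natCast]
    refine inv_anti₀ (by positivity) (pow_le_pow_left₀ (by positivity) ?_ _)
    push_cast
    have : (0 : ℝ) ≤ k := by positivity
    linarith
  have hbs' : ∀ N, Summable fun k => b (k + (N + 1)) := fun N => (summable_nat_add_iff (N + 1)).2 hbs
  have hes : Summable e := (summable_nat_add_iff 1).1
    (Summable.of_norm_bounded ((hbs' 0).mul_left _) (hle 0))
  refine ⟨∑' k, e k, IsBigO.of_bound (C * ∑' k, b k) (Eventually.of_forall fun N => ?_)⟩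
  have h1 := hes.sum_add_tsum_nat_add (N + 1)
  have h2 : (psum e - fun _ => ∑' k, e k : ℕ → ℝ) N = -∑' k, e (k + (N + 1)) := by
    simp only [Pi.sub_apply, psum_apply]
    linarith
  rw [h2, norm_neg, Real.norm_of_nonneg (by positivity : 0 ≤ ((N : ℝ) + 1) ^ (-(M : ℤ)))]
  refine (tsum_of_norm_bounded ((hbs' N).mul_left _).hasSum (hle N)).trans ?_
  rw [tsum_mul_left, mul_right_comm]
  have hC0 : 0 ≤ C := by
    have := (norm_nonneg _).trans (hC 0)
    simpa using this
  refine mul_le_mul_of_nonneg_right (mul_le_mul_of_nonneg_left ?_ hC0) (by positivity)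
  have h3 := hbs.sum_add_tsum_nat_add (N + 1)
  have h4 : 0 ≤ ∑ k ∈ Finset.range (N + 1), b k := Finset.sum_nonneg fun k _ => by positivity
  linarith

lemma tendsto_zpow_neg {j : ℤ} (hj : j < 0) :
    Tendsto (fun N : ℕ => ((N : ℝ) + 1) ^ j) atTop (𝓝 0) := by
  have := logMonomial_isLittleO_zpow 0 hj
  simp only [zpow_zero, isLittleO_one_iff] at this
  refine this.congr fun N => ?_
  simp [logMonomial]

lemma tendsto_logMonomialSpan {Z : Submodule ℚ ℝ} {d : ℤ} (hd : d < 0) {f : ℕ → ℝ}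
    (hf : f ∈ logMonomialSpan Z d) : Tendsto f atTop (𝓝 0) := by
  induction hf using Submodule.span_induction with
  | mem f hf =>
    obtain ⟨c, -, i, j, hj, rfl⟩ := hf
    have := logMonomial_isLittleO_zpow i (hj.trans_lt hd)
    simp only [zpow_zero, isLittleO_one_iff] at this
    simpa using this.const_mul c
  | zero => exact tendsto_const_nhds
  | add f g _ _ hf hg =>
    have := hf.add hg
    rwa [add_zero] at this
  | smul q f _ hf =>
    have := hf.const_mul (q : ℝ)
    rw [mul_zero] at this
    exact this.congr fun N => by simp [Rat.smul_def]

theorem exists_tendsto_psum {Z : Submodule ℚ ℝ} {d : ℤ} (hd : d ≤ -2) {f : ℕ → ℝ}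
    (hf : f ∈ AsympExp Z d) : ∃ C : ℝ, Tendsto (psum f) atTop (𝓝 C) ∧
      (psum f - fun _ => C) ∈ AsympExp Z (d + 1) := by
  have key : ∀ M : ℕ, ∃ F ∈ logMonomialSpan Z (d + 1), ∃ C : ℝ,
      (psum f - (fun _ => C) - F) =O[atTop] fun N : ℕ => ((N : ℝ) + 1) ^ (-(M : ℤ)) := by
    intro M
    obtain ⟨g, hg, hO⟩ := mem_AsympExp.1 hf (M + 2)
    obtain ⟨F, hF, hO'⟩ := exists_antideriv hd (M + 2) hg
    obtain ⟨C, hC⟩ := psum_sub_const_isBigO (hO.add hO')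
    -- The shift by `F 0` is the boundary term of the telescoping sum.
    refine ⟨F, hF, C - F 0, hC.congr_left fun N => ?_⟩
    have e : (fun x => (f - g) x + (g - backDiff F) x) = f - backDiff F := by
      ext N; simp
    rw [e, map_sub]
    simp only [Pi.sub_apply, psum_backDiff]
    ring
  -- The constant could depend on the precision `M`; it does not, being the limit of the partial
  -- sums.
  have lim : ∀ (M : ℕ) (F : ℕ → ℝ) (C : ℝ), 1 ≤ M → F ∈ logMonomialSpan Z (d + 1) →
      (psum f - (fun _ => C) - F) =O[atTop] (fun N : ℕ => ((N : ℝ) + 1) ^ (-(M : ℤ))) →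
      Tendsto (psum f) atTop (𝓝 C) := by
    intro M F C hM hF hO
    have h1 := hO.trans_tendsto (tendsto_zpow_neg (by omega))
    have h2 := (h1.add (tendsto_logMonomialSpan (by omega) hF)).add_const C
    rw [add_zero, zero_add] at h2
    exact h2.congr fun N => by simp
  obtain ⟨F, hF, C, hO⟩ := key 1
  refine ⟨C, lim 1 F C le_rfl hF hO, fun M => ?_⟩
  obtain ⟨F', hF', C', hO'⟩ := key (M + 1)
  obtain rfl := tendsto_nhds_unique (lim 1 F C le_rfl hF hO) (lim _ F' C' (by omega) hF' hO')
  exact ⟨F', hF', hO'.trans (zpow_isBigO_zpow (by push_cast; omega))⟩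

/-! ### The limit as a coefficient of the expansion -/

lemma exists_finsupp_of_mem_logMonomialSpan {Z : Submodule ℚ ℝ} {d : ℤ} {f : ℕ → ℝ}
    (hf : f ∈ logMonomialSpan Z d) : ∃ c : ℤ ×ₗ ℕ →₀ ℝ, (∀ x, c x ∈ Z) ∧
      ∀ N, f N = c.sum fun x a => a * logMonomial (ofLex x).2 (ofLex x).1 N := by
  classical
  induction hf using Submodule.span_induction with
  | mem f hf =>
    obtain ⟨c, hc, i, j, -, rfl⟩ := hf
    refine ⟨Finsupp.single (toLex (j, i)) c, fun x => ?_, fun N => ?_⟩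
    · rw [Finsupp.single_apply]
      split_ifs
      exacts [hc, zero_mem _]
    · rw [Finsupp.sum_single_index (by simp)]
      simp
  | zero => exact ⟨0, fun x => zero_mem _, fun N => by simp⟩
  | add f g _ _ hf hg =>
    obtain ⟨c, hc, h⟩ := hf
    obtain ⟨c', hc', h'⟩ := hg
    refine ⟨c + c', fun x => add_mem (hc x) (hc' x), fun N => ?_⟩
    rw [Finsupp.sum_add_index' (by simp) (by intros; ring), Pi.add_apply, h, h']
  | smul q f _ hf =>
    obtain ⟨c, hc, h⟩ := hf
    refine ⟨q • c, fun x => Z.smul_mem _ (hc x), fun N => ?_⟩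
    rw [Finsupp.sum_smul_index' (by simp), Pi.smul_apply, h, Finsupp.smul_sum]
    simp only [smul_mul_assoc]

lemma logMonomial_isLittleO_of_lex_lt {x y : ℤ ×ₗ ℕ} (h : x < y) :
    logMonomial (ofLex x).2 (ofLex x).1 =o[atTop] logMonomial (ofLex y).2 (ofLex y).1 :=
  logMonomial_isLittleO (Prod.Lex.lt_iff.1 h)

/-- If the coefficient at `(0, 0)` were nonzero, the lexicographically largest monomial present
would dominate a constant. The whole combination and all its other terms would be negligible against
that monomial, and hence so would the monomial itself. -/
lemma finsupp_apply_zero_of_tendsto {c : ℤ ×ₗ ℕ →₀ ℝ}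
    (h : Tendsto (fun N => c.sum fun x a => a * logMonomial (ofLex x).2 (ofLex x).1 N) atTop
      (𝓝 0)) : c (toLex (0, 0)) = 0 := by
  classical
  by_cases hc : c.support = ∅
  · rw [Finsupp.support_eq_empty.1 hc]; rfl
  have hne := Finset.nonempty_iff_ne_empty.2 hc
  set x₀ := c.support.max' hne with hx₀
  have hmem : x₀ ∈ c.support := Finset.max'_mem _ _
  by_contra h0
  have hle : toLex ((0 : ℤ), 0) ≤ x₀ := Finset.le_max' _ _ (Finsupp.mem_support_iff.2 h0)
  set m := logMonomial (ofLex x₀).2 (ofLex x₀).1 with hm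
  have h1 : (fun _ : ℕ => (1 : ℝ)) =O[atTop] m := by
    have e : (fun _ : ℕ => (1 : ℝ)) = logMonomial 0 0 := by ext N; simp [logMonomial]
    rcases hle.eq_or_lt with heq | hlt
    · rw [hm, ← heq, e]
      exact isBigO_refl _ _
    · rw [e]
      exact (logMonomial_isLittleO_of_lex_lt hlt).isBigO
  have h2 := ((isLittleO_one_iff ℝ).2 h).trans_isBigO h1
  have h3 : (fun N => ∑ x ∈ c.support.erase x₀, c x * logMonomial (ofLex x).2 (ofLex x).1 N)
      =o[atTop] m := by
    refine IsLittleO.fun_sum fun x hx => ?_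
    exact (logMonomial_isLittleO_of_lex_lt (lt_of_le_of_ne
      (Finset.le_max' _ _ (Finset.mem_of_mem_erase hx)) (Finset.ne_of_mem_erase hx))).const_mul_left _
  have h4 : (fun N => c x₀ * m N) =o[atTop] m := by
    refine (h2.sub h3).congr_left fun N => ?_
    rw [Finsupp.sum, ← Finset.add_sum_erase _ _ hmem]
    ring
  rw [isLittleO_const_mul_left_iff (Finsupp.mem_support_iff.1 hmem)] at h4
  have h5 : ∃ᶠ N in atTop, m N ≠ 0 := by
    refine (Eventually.of_forall fun N => ?_).frequently
    have := harm_pos N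
    simp only [hm, logMonomial]
    positivity
  exact isLittleO_irrefl h5 h4

theorem mem_of_tendsto_of_mem_AsympExp {Z : Submodule ℚ ℝ} {d : ℤ} {f : ℕ → ℝ} {S : ℝ}
    (hf : f ∈ AsympExp Z d) (hS : Tendsto f atTop (𝓝 S)) : S ∈ Z := by
  obtain ⟨g, hg, hO⟩ := mem_AsympExp.1 hf 1
  have h1 := hO.trans_tendsto (tendsto_zpow_neg (by norm_num))
  have hgS : Tendsto g atTop (𝓝 S) := by
    have := hS.sub h1
    rw [sub_zero] at this
    exact this.congr fun N => by simp
  obtain ⟨c, hc, h⟩ := exists_finsupp_of_mem_logMonomialSpan hg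
  have h2 : (c - Finsupp.single (toLex ((0 : ℤ), 0)) S : ℤ ×ₗ ℕ →₀ ℝ) (toLex (0, 0)) = 0 := by
    refine finsupp_apply_zero_of_tendsto ?_
    have := hgS.sub_const S
    rw [sub_self] at this
    refine this.congr fun N => ?_
    rw [Finsupp.sum_sub_index (by intros; ring), Finsupp.sum_single_index (by simp), h]
    simp [logMonomial]
  rw [Finsupp.sub_apply, Finsupp.single_eq_same, sub_eq_zero] at h2
  exact h2 ▸ hc _

/-! ### Multiple zeta values as limits of multiple harmonic sums -/

lemma sum_Icc_one_eq_sum_range (f : ℕ → ℝ) (N : ℕ) :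
    ∑ a ∈ Finset.Icc 1 N, f a = ∑ k ∈ Finset.range N, f (k + 1) := by
  induction N with
  | zero => simp
  | succ N ih => rw [Finset.sum_Icc_succ_top (by omega), Finset.sum_range_succ, ih]

open Classical in
/-- The finite set of the `k = (k₁, …, k_q)` with `N ≥ k₁ > k₂ > ⋯ > k_q ≥ 1`. -/
def strictChainsUpTo (q N : ℕ) : Finset (Fin q → ℕ) :=
  (Fintype.piFinset fun _ : Fin q => Finset.Icc 1 N).filter fun k => StrictAnti k

lemma mem_strictChainsUpTo {q N : ℕ} {k : Fin q → ℕ} :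
    k ∈ strictChainsUpTo q N ↔ (∀ j, 1 ≤ k j ∧ k j ≤ N) ∧ StrictAnti k := by
  simp [strictChainsUpTo]

lemma strictAnti_cons {q a : ℕ} {t : Fin q → ℕ} :
    StrictAnti (Fin.cons a t : Fin (q + 1) → ℕ) ↔ (∀ j, t j < a) ∧ StrictAnti t := by
  refine ⟨fun h => ⟨fun j => ?_, fun i j hij => ?_⟩, fun h i j => ?_⟩
  · simpa using h (Fin.succ_pos j)
  · simpa using h (Fin.succ_lt_succ_iff.2 hij)
  · refine Fin.cases ?_ (fun i => ?_) i <;> refine Fin.cases ?_ (fun j => ?_) j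
    · simp
    · simpa using h.1 j
    · simp
    · simpa using fun hij => h.2 hij

/-- The largest entry `a + 1` is split off; the others are strictly smaller, so bounded by `a`. This
matches the recursion of `mhs`. -/
lemma sum_strictChainsUpTo_succ (q N : ℕ) (F : (Fin (q + 1) → ℕ) → ℝ) :
    ∑ k ∈ strictChainsUpTo (q + 1) N, F k =
      ∑ a ∈ Finset.range N, ∑ t ∈ strictChainsUpTo q a, F (Fin.cons (a + 1) t) := by
  have := sum_Icc_one_eq_sum_range
    (fun a => ∑ t ∈ strictChainsUpTo q (a - 1), F (Fin.cons a t)) N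
  simp only [Nat.add_sub_cancel] at this
  rw [← this, Finset.sum_sigma']
  refine Finset.sum_nbij' (fun k => ⟨k 0, Fin.tail k⟩) (fun x => Fin.cons x.1 x.2) ?_ ?_ ?_ ?_ ?_
  · intro k hk
    rw [← Fin.cons_self_tail k] at hk
    simp only [mem_strictChainsUpTo, strictAnti_cons, Fin.forall_fin_succ, Fin.cons_zero,
      Fin.cons_succ] at hk
    simp only [Finset.mem_sigma, Finset.mem_Icc, mem_strictChainsUpTo]
    exact ⟨hk.1.1, fun j => ⟨(hk.1.2 j).1, by have := hk.2.1 j; omega⟩, hk.2.2⟩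
  · rintro ⟨a, t⟩ h
    simp only [Finset.mem_sigma, Finset.mem_Icc, mem_strictChainsUpTo] at h
    simp only [mem_strictChainsUpTo, strictAnti_cons, Fin.forall_fin_succ, Fin.cons_zero,
      Fin.cons_succ]
    exact ⟨⟨h.1, fun j => by have := h.2.1 j; omega⟩, fun j => by have := h.2.1 j; omega, h.2.2⟩
  · intro k _
    exact Fin.cons_self_tail k
  · rintro ⟨a, t⟩ _
    simp
  · intro k _
    rw [Fin.cons_self_tail]

lemma mhs_ofFn {q : ℕ} (s : Fin q → ℕ) (N : ℕ) :
    mhs (List.ofFn s) N = ∑ k ∈ strictChainsUpTo q N, ∏ j, 1 / ((k j : ℝ) ^ s j) := by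
  induction q generalizing N with
  | zero =>
    have : strictChainsUpTo 0 N = {default} := by
      ext k
      simp [mem_strictChainsUpTo, Subsingleton.elim k default, Subsingleton.strictAnti]
    rw [this]
    simp [mhs]
  | succ q ih =>
    rw [sum_strictChainsUpTo_succ, List.ofFn_succ, mhs]
    refine Finset.sum_congr rfl fun a _ => ?_
    rw [ih, Finset.mul_sum]
    refine Finset.sum_congr rfl fun t _ => ?_
    rw [Fin.prod_univ_succ]
    simp

lemma mhs_nonneg (s : List ℕ) (N : ℕ) : 0 ≤ mhs s N := by
  induction s generalizing N with
  | nil => simp [mhs]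
  | cons a s ih => exact Finset.sum_nonneg fun k _ => mul_nonneg (by positivity) (ih k)

lemma mhs_cons_succ (a : ℕ) (s : List ℕ) (N : ℕ) :
    mhs (a :: s) (N + 1) = mhs (a :: s) N + 1 / ((N : ℝ) + 1) ^ a * mhs s N := by
  rw [mhs, Finset.sum_range_succ]
  rfl

lemma mhs_monotone (s : List ℕ) : Monotone (mhs s) := by
  cases s with
  | nil => exact fun _ _ _ => le_rfl
  | cons a s =>
    refine monotone_nat_of_le_succ fun N => ?_
    rw [mhs_cons_succ]
    have := mul_nonneg (show 0 ≤ 1 / ((N : ℝ) + 1) ^ a by positivity) (mhs_nonneg s N)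
    linarith

/-- The multiple zeta value is the limit of the multiple harmonic sums. -/
lemma multiZeta_eq_of_tendsto {q : ℕ} (s : Fin q → ℕ) {C : ℝ}
    (h : Tendsto (mhs (List.ofFn s)) atTop (𝓝 C)) : multiZeta s = C := by
  classical
  have hle : ∀ N, mhs (List.ofFn s) N ≤ C := fun N => (mhs_monotone _).ge_of_tendsto h N
  refine HasSum.tsum_eq (hasSum_of_isLUB_of_nonneg C
    (fun k => Finset.prod_nonneg fun j _ => by positivity) ⟨?_, fun B hB => ?_⟩)
  · rintro _ ⟨u, rfl⟩
    -- The cutoff is the largest entry occurring in the finite set `u`.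
    refine le_trans ?_ (hle (u.sup fun k => Finset.univ.sup k.1))
    rw [mhs_ofFn]
    refine (Finset.sum_map u (Function.Embedding.subtype _)
      (fun k : Fin q → ℕ => ∏ j, 1 / ((k j : ℝ) ^ s j))).symm.trans_le ?_
    refine Finset.sum_le_sum_of_subset_of_nonneg (fun k hk => ?_)
      fun k _ _ => Finset.prod_nonneg fun j _ => by positivity
    obtain ⟨⟨k, hk1, hk2⟩, hku, rfl⟩ := Finset.mem_map.1 hk
    refine mem_strictChainsUpTo.2 ⟨fun j => ⟨hk2 j, ?_⟩, hk1⟩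
    exact le_trans (Finset.le_sup (f := k) (Finset.mem_univ j))
      (Finset.le_sup (f := fun k : {k : Fin q → ℕ // StrictAnti k ∧ ∀ j, 1 ≤ k j} =>
        Finset.univ.sup k.1) hku)
  · refine le_of_tendsto' h fun N => ?_
    refine le_trans (le_of_eq ?_) (hB ⟨(strictChainsUpTo q N).subtype
      (fun k => StrictAnti k ∧ ∀ j, 1 ≤ k j), rfl⟩)
    dsimp only
    rw [mhs_ofFn, Finset.sum_subtype_of_mem (fun k : Fin q → ℕ => ∏ j, 1 / ((k j : ℝ) ^ s j))]
    intro k hk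
    rw [mem_strictChainsUpTo] at hk
    exact ⟨hk.2, fun j => (hk.1 j).1⟩

lemma multiZetaSpan_mono {p p' w w' : ℕ} (hp : p ≤ p') (hw : w ≤ w') :
    multiZetaSpan p w ≤ multiZetaSpan p' w' :=
  Submodule.span_mono fun _ ⟨q, hq, s, h1, h2, h3, h4⟩ =>
    ⟨q, hq.trans hp, s, h1, h2, h3.trans hw, h4⟩

lemma one_mem_multiZetaSpan (p w : ℕ) : (1 : ℝ) ∈ multiZetaSpan p w := by
  refine Submodule.subset_span ⟨0, Nat.zero_le _, Fin.elim0, fun i => i.elim0, fun h => by omega,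
    by simp, ?_⟩
  refine (multiZeta_eq_of_tendsto _ ?_).symm
  simp [mhs]

/-! ### Stuffle product and removal of leading ones -/

/-- The operator `f ↦ ∑_{k < N} f(k) / (k + 1) ^ a`, with `mhs (a :: s) = prepend a (mhs s)`. -/
def prepend (a : ℕ) : (ℕ → ℝ) →ₗ[ℚ] (ℕ → ℝ) where
  toFun f N := ∑ k ∈ Finset.range N, 1 / ((k : ℝ) + 1) ^ a * f k
  map_add' f g := by ext N; simp [Finset.sum_add_distrib, mul_add]
  map_smul' q f := by ext N; simp [Finset.smul_sum]

lemma prepend_mhs (a : ℕ) (s : List ℕ) : prepend a (mhs s) = mhs (a :: s) := rfl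

/-- The stuffle product of a multiple harmonic sum with a harmonic number. -/
lemma mhs_one_mul_mhs_cons (a : ℕ) (s : List ℕ) :
    mhs [1] * mhs (a :: s) =
      prepend 1 (mhs (a :: s)) + prepend a (mhs [1] * mhs s) + prepend (a + 1) (mhs s) := by
  ext N
  induction N with
  | zero => simp [mhs, prepend]
  | succ N ih =>
    simp only [Pi.add_apply, Pi.mul_apply] at ih ⊢
    rw [mhs_cons_succ, mhs_cons_succ]
    simp only [prepend, LinearMap.coe_mk, AddHom.coe_mk, Finset.sum_range_succ, Pi.mul_apply] at ih ⊢
    have h1 : mhs [] N = 1 := rfl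
    rw [h1]
    have : (N : ℝ) + 1 ≠ 0 := by positivity
    have e : 1 / ((N : ℝ) + 1) ^ (a + 1) = 1 / ((N : ℝ) + 1) ^ 1 * (1 / ((N : ℝ) + 1) ^ a) := by
      rw [pow_succ]; field_simp
    rw [e]
    linear_combination ih

/-- The span of the multiple harmonic sums of depth at most `q` and weight at most `w`. -/
def harmonicSpan (q w : ℕ) : Submodule ℚ (ℕ → ℝ) :=
  Submodule.span ℚ {f | ∃ s : List ℕ, (∀ x ∈ s, 1 ≤ x) ∧ s.length ≤ q ∧ s.sum ≤ w ∧ f = mhs s}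

/-- The span of the multiple harmonic sums of depth at most `q` and weight at most `w` whose index
has at most `m` leading ones. -/
def leadingOnesSpan (m q w : ℕ) : Submodule ℚ (ℕ → ℝ) :=
  Submodule.span ℚ {f | ∃ (l : ℕ) (s : List ℕ), l ≤ m ∧ (∀ x ∈ s, 1 ≤ x) ∧ (∀ x ∈ s.head?, 2 ≤ x) ∧
    l + s.length ≤ q ∧ l + s.sum ≤ w ∧ f = mhs (List.replicate l 1 ++ s)}

lemma mhs_mem_harmonicSpan {s : List ℕ} (hs : ∀ x ∈ s, 1 ≤ x) {q w : ℕ} (hq : s.length ≤ q)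
    (hw : s.sum ≤ w) : mhs s ∈ harmonicSpan q w :=
  Submodule.subset_span ⟨s, hs, hq, hw, rfl⟩

lemma mhs_mem_leadingOnesSpan {l m q w : ℕ} {s : List ℕ} (hl : l ≤ m) (hs : ∀ x ∈ s, 1 ≤ x)
    (hs' : ∀ x ∈ s.head?, 2 ≤ x) (hq : l + s.length ≤ q) (hw : l + s.sum ≤ w) :
    mhs (List.replicate l 1 ++ s) ∈ leadingOnesSpan m q w :=
  Submodule.subset_span ⟨l, s, hl, hs, hs', hq, hw, rfl⟩

lemma prepend_mem_harmonicSpan {a q w : ℕ} (ha : 1 ≤ a) {f : ℕ → ℝ} (hf : f ∈ harmonicSpan q w) :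
    prepend a f ∈ harmonicSpan (q + 1) (w + a) := by
  refine Submodule.span_le (p := (harmonicSpan (q + 1) (w + a)).comap (prepend a)).2 ?_ hf
  rintro _ ⟨s, hs, hq, hw, rfl⟩
  exact mhs_mem_harmonicSpan (s := a :: s) (by simpa using ⟨ha, hs⟩) (by simpa using hq)
    (by simp; omega)

lemma prepend_mem_leadingOnesSpan {a m q w : ℕ} (ha : 2 ≤ a) {f : ℕ → ℝ}
    (hf : f ∈ harmonicSpan q w) : prepend a f ∈ leadingOnesSpan m (q + 1) (w + a) := by
  refine Submodule.span_le (p := (leadingOnesSpan m (q + 1) (w + a)).comap (prepend a)).2 ?_ hf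
  rintro _ ⟨s, hs, hq, hw, rfl⟩
  exact mhs_mem_leadingOnesSpan (l := 0) (s := a :: s) (Nat.zero_le _)
    (by simpa using ⟨by omega, hs⟩) (by simpa using ha) (by simp; omega) (by simp; omega)

lemma prepend_one_mem_leadingOnesSpan {m q w : ℕ} {f : ℕ → ℝ} (hf : f ∈ leadingOnesSpan m q w) :
    prepend 1 f ∈ leadingOnesSpan (m + 1) (q + 1) (w + 1) := by
  refine Submodule.span_le (p := (leadingOnesSpan (m + 1) (q + 1) (w + 1)).comap (prepend 1)).2 ?_ hf
  rintro _ ⟨l, s, hl, hs, hs', hq, hw, rfl⟩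
  exact mhs_mem_leadingOnesSpan (l := l + 1) (by omega) hs hs' (by omega) (by omega)

lemma mhs_one_mul_mem_harmonicSpan {s : List ℕ} (hs : ∀ x ∈ s, 1 ≤ x) :
    mhs [1] * mhs s ∈ harmonicSpan (s.length + 1) (s.sum + 1) := by
  induction s with
  | nil =>
    have : mhs [1] * mhs [] = mhs [1] := by ext N; simp [mhs]
    rw [this]
    exact mhs_mem_harmonicSpan (by simp) (by simp) (by simp)
  | cons a s ih =>
    simp only [List.mem_cons, forall_eq_or_imp] at hs
    rw [mhs_one_mul_mhs_cons]
    refine add_mem (add_mem ?_ ?_) ?_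
    · exact prepend_mem_harmonicSpan le_rfl
        (mhs_mem_harmonicSpan (by simpa using hs) le_rfl le_rfl)
    · have := prepend_mem_harmonicSpan hs.1 (ih hs.2)
      simp only [List.length_cons, List.sum_cons]
      convert this using 2
      ring
    · exact mhs_mem_harmonicSpan (s := (a + 1) :: s) (by simpa using hs.2) (by simp) (by simp; omega)

/-- In the stuffle product the extra one can be inserted at `m + 1` places of the leading block,
always with the same result. Every other term has at most `m` leading ones, so the sum with `m + 1`
of them can be solved for. -/
lemma mhs_one_mul_leadingOnes (m : ℕ) {s : List ℕ} (hs : ∀ x ∈ s, 1 ≤ x)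
    (hs' : ∀ x ∈ s.head?, 2 ≤ x) :
    mhs [1] * mhs (List.replicate m 1 ++ s)
      - ((m : ℚ) + 1) • mhs (List.replicate (m + 1) 1 ++ s)
      ∈ leadingOnesSpan m (m + 1 + s.length) (m + 1 + s.sum) := by
  induction m with
  | zero =>
    cases s with
    | nil =>
      have e : mhs [1] * mhs (List.replicate 0 1 ++ [])
          - (((0 : ℕ) : ℚ) + 1) • mhs (List.replicate (0 + 1) 1 ++ []) = 0 := by
        ext N
        simp [mhs]
      rw [e]
      exact zero_mem _
    | cons b t =>
      simp only [List.mem_cons, forall_eq_or_imp] at hs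
      have hb : 2 ≤ b := hs' b (by simp)
      have e : mhs [1] * mhs (List.replicate 0 1 ++ b :: t)
          - (((0 : ℕ) : ℚ) + 1) • mhs (List.replicate (0 + 1) 1 ++ b :: t) =
          prepend b (mhs [1] * mhs t) + prepend (b + 1) (mhs t) := by
        simp only [List.replicate, List.nil_append, List.cons_append, mhs_one_mul_mhs_cons,
          prepend_mhs, Nat.cast_zero, zero_add, one_smul]
        ring
      rw [e]
      refine add_mem ?_ ?_
      · have := prepend_mem_leadingOnesSpan (m := 0) hb (mhs_one_mul_mem_harmonicSpan hs.2)
        simp only [List.length_cons, List.sum_cons]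
        convert this using 2 <;> ring
      · exact mhs_mem_leadingOnesSpan (l := 0) (s := (b + 1) :: t) le_rfl
          (by simpa using hs.2) (by simp; omega) (by simp) (by simp; omega)
  | succ m ih =>
    have h1 := prepend_one_mem_leadingOnesSpan ih
    -- The term in which the new one merges with the first leading one.
    have h2 : mhs (2 :: (List.replicate m 1 ++ s)) ∈
        leadingOnesSpan (m + 1) (m + 1 + s.length + 1) (m + 1 + s.sum + 1) :=
      mhs_mem_leadingOnesSpan (l := 0) (s := 2 :: (List.replicate m 1 ++ s)) (Nat.zero_le _)
        (by
          simp only [List.mem_cons, List.mem_append, List.mem_replicate]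
          rintro x (rfl | ⟨-, rfl⟩ | h)
          exacts [by omega, le_rfl, hs x h])
        (by simp) (by simp) (by simp; omega)
    convert add_mem h1 h2 using 1
    · congr 1 <;> ring
    · rw [map_sub, map_smul, prepend_mhs]
      simp only [List.replicate_succ, List.cons_append, mhs_one_mul_mhs_cons, prepend_mhs]
      push_cast
      module

lemma exists_leadingOnes (s : List ℕ) (hs : ∀ x ∈ s, 1 ≤ x) : ∃ (m : ℕ) (t : List ℕ),
    (∀ x ∈ t, 1 ≤ x) ∧ (∀ x ∈ t.head?, 2 ≤ x) ∧ s = List.replicate m 1 ++ t := by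
  induction s with
  | nil => exact ⟨0, [], by simp, by simp, by simp⟩
  | cons a s ih =>
    simp only [List.mem_cons, forall_eq_or_imp] at hs
    rcases hs.1.eq_or_lt with rfl | ha
    · obtain ⟨m, t, h1, h2, rfl⟩ := ih hs.2
      exact ⟨m + 1, t, h1, h2, by simp [List.replicate_succ]⟩
    · exact ⟨0, a :: s, by simpa using hs, by simp; omega, by simp⟩

/-! ### Expansions of multiple harmonic sums -/

/-- From an expansion of `N ↦ mhs s (N + 1)` to one of `N ↦ mhs s N`. -/
lemma mhs_mem_AsympExp_of_succ (n : ℕ)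
    (H : ∀ s : List ℕ, (∀ x ∈ s, 1 ≤ x) → s.length ≤ n →
      (fun N => mhs s (N + 1)) ∈ AsympExp (multiZetaSpan s.length s.sum) 0)
    (s : List ℕ) (hs : ∀ x ∈ s, 1 ≤ x) (hn : s.length ≤ n) :
    mhs s ∈ AsympExp (multiZetaSpan s.length s.sum) 0 := by
  induction s with
  | nil => exact H [] hs hn
  | cons a s ih =>
    have h1 := H (a :: s) hs hn
    simp only [List.mem_cons, forall_eq_or_imp, List.length_cons] at hs hn
    have h2 := AsympExp_mono (multiZetaSpan_mono (Nat.le_succ _) (Nat.le_add_left _ a))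
      (show (0 + -a : ℤ) ≤ 0 by omega) (AsympExp_mul (ih hs.2 (by omega)) (zpow_mem_AsympExp (-a)))
    refine AsympExp_congr (sub_mem h1 h2) (Eventually.of_forall fun N => ?_)
    simp only [Pi.sub_apply, Pi.mul_apply, mhs_cons_succ, zpow_neg, zpow_natCast]
    ring

/-- As `b ≥ 2`, the summands have degree at most `-2` and can be summed termwise. The only new
coefficient is the limit, the zeta value of `b :: s`. -/
lemma mhs_cons_mem_AsympExp {b : ℕ} (hb : 2 ≤ b) {s : List ℕ} (hs : ∀ x ∈ s, 1 ≤ x)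
    (h : mhs s ∈ AsympExp (multiZetaSpan s.length s.sum) 0) :
    (fun N => mhs (b :: s) (N + 1)) ∈ AsympExp (multiZetaSpan (s.length + 1) (b + s.sum)) 0 := by
  have h1 := AsympExp_mul h (zpow_mem_AsympExp (-b))
  obtain ⟨C, hC, hC'⟩ := exists_tendsto_psum (by omega) h1
  have e : psum (mhs s * fun N : ℕ => ((N : ℝ) + 1) ^ (-(b : ℤ))) =
      fun N => mhs (b :: s) (N + 1) := by
    ext N
    rw [psum_apply, mhs]
    refine Finset.sum_congr rfl fun k _ => ?_
    rw [Pi.mul_apply, zpow_neg, zpow_natCast]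
    ring
  rw [e] at hC hC'
  have hz : multiZeta (b :: s).get = C := by
    refine multiZeta_eq_of_tendsto _ ?_
    rw [List.ofFn_get]
    exact (tendsto_add_atTop_iff_nat 1).1 hC
  have hCm : C ∈ multiZetaSpan (s.length + 1) (b + s.sum) := by
    refine Submodule.subset_span ⟨_, le_rfl, (b :: s).get, fun i => ?_, fun _ => hb, ?_, hz.symm⟩
    · have := List.get_mem (b :: s) i
      rcases List.mem_cons.1 this with h | h
      · omega
      · exact hs _ h
    · rw [← List.sum_ofFn, List.ofFn_get, List.sum_cons]
  have := add_mem (AsympExp_mono (multiZetaSpan_mono (Nat.le_succ s.length) (Nat.le_add_left s.sum b))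
    (show (0 + -b + 1 : ℤ) ≤ 0 by omega) hC') (const_mem_AsympExp hCm)
  simpa using this

/-- Multiple harmonic sums have asymptotic expansions whose coefficients are combinations of
multiple zeta values of no larger depth and weight. -/
theorem mhs_mem_AsympExp (s : List ℕ) (hs : ∀ x ∈ s, 1 ≤ x) :
    (fun N => mhs s (N + 1)) ∈ AsympExp (multiZetaSpan s.length s.sum) 0 := by
  suffices H : ∀ (n : ℕ) (s : List ℕ), (∀ x ∈ s, 1 ≤ x) → s.length ≤ n →
      (fun N => mhs s (N + 1)) ∈ AsympExp (multiZetaSpan s.length s.sum) 0 from H _ s hs le_rfl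
  intro n
  induction n with
  | zero =>
    intro s _ hn
    obtain rfl := List.length_eq_zero_iff.1 (Nat.le_zero.1 hn)
    exact const_mem_AsympExp (one_mem_multiZetaSpan _ _)
  | succ n ih =>
    suffices H : ∀ (m : ℕ) (t : List ℕ), (∀ x ∈ t, 1 ≤ x) → (∀ x ∈ t.head?, 2 ≤ x) →
        m + t.length ≤ n + 1 → (fun N => mhs (List.replicate m 1 ++ t) (N + 1)) ∈
          AsympExp (multiZetaSpan (m + t.length) (m + t.sum)) 0 by
      intro s hs hn
      obtain ⟨m, t, ht, ht', rfl⟩ := exists_leadingOnes s hs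
      simpa using H m t ht ht' (by simpa using hn)
    -- Inner induction on the number of leading ones, inside the outer one on the length.
    intro m
    induction m using Nat.strong_induction_on with
    | _ m ihm =>
    intro t ht ht' hn
    rcases m with _ | m
    · cases t with
      | nil => exact const_mem_AsympExp (one_mem_multiZetaSpan _ _)
      | cons b t =>
        simp only [List.mem_cons, forall_eq_or_imp, List.length_cons] at ht hn
        simpa using mhs_cons_mem_AsympExp (ht' b (by simp)) ht.2
          (mhs_mem_AsympExp_of_succ n ih t ht.2 (by omega))
    -- The stuffle relation is solved for the sum with `m + 1` leading ones; the correction terms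
    -- may have fewer than `m`, hence the strong induction.
    · have h1 := AsympExp_mono (multiZetaSpan_mono (show m + t.length ≤ m + 1 + t.length by omega)
        (show m + t.sum ≤ m + 1 + t.sum by omega)) (show (0 + 0 : ℤ) ≤ 0 by simp)
        (AsympExp_mul (ihm m (by omega) t ht ht' (by omega)) harm_mem_AsympExp)
      have h2 : ∀ f ∈ leadingOnesSpan m (m + 1 + t.length) (m + 1 + t.sum),
          (fun N => f (N + 1)) ∈ AsympExp (multiZetaSpan (m + 1 + t.length) (m + 1 + t.sum)) 0 := by
        intro f hf
        refine Submodule.span_le (p := (AsympExp (multiZetaSpan (m + 1 + t.length)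
          (m + 1 + t.sum)) 0).comap (LinearMap.funLeft ℚ ℝ fun N : ℕ => N + 1)).2 ?_ hf
        rintro _ ⟨l, u, hl, hu, hu', hq, hw, rfl⟩
        exact AsympExp_mono (multiZetaSpan_mono hq hw) le_rfl
          (ihm l (by omega) u hu hu' (by omega))
      have h3 := Submodule.smul_mem _ ((m : ℚ) + 1)⁻¹
        (sub_mem h1 (h2 _ (mhs_one_mul_leadingOnes m ht ht')))
      refine AsympExp_congr h3 (Eventually.of_forall fun N => ?_)
      have : (m : ℝ) + 1 ≠ 0 := by positivity
      simp only [Pi.sub_apply, Pi.mul_apply, Pi.smul_apply, Rat.smul_def, harm]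
      push_cast
      field_simp
      ring

/-! ### Rational functions and partial fractions -/

/-- The combinations of the functions `k ↦ (k + 1) ^ m` and `k ↦ 1 / (k + 1 + i) ^ a` with
`1 ≤ a ≤ w`. -/
def ratSpan (w : ℕ) : Submodule ℚ (ℕ → ℝ) :=
  Submodule.span ℚ ({f | ∃ m : ℕ, f = fun k : ℕ => ((k : ℝ) + 1) ^ m} ∪
    {f | ∃ i a : ℕ, 1 ≤ a ∧ a ≤ w ∧ f = fun k : ℕ => 1 / ((k : ℝ) + 1 + i) ^ a})

lemma pow_mem_ratSpan (m w : ℕ) : (fun k : ℕ => ((k : ℝ) + 1) ^ m) ∈ ratSpan w :=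
  Submodule.subset_span (Or.inl ⟨m, rfl⟩)

lemma one_mem_ratSpan (w : ℕ) : (1 : ℕ → ℝ) ∈ ratSpan w := by
  convert pow_mem_ratSpan 0 w using 1
  ext k
  simp

lemma inv_pow_mem_ratSpan (i : ℕ) {a w : ℕ} (h : a ≤ w) :
    (fun k : ℕ => 1 / ((k : ℝ) + 1 + i) ^ a) ∈ ratSpan w := by
  rcases Nat.eq_zero_or_pos a with rfl | ha
  · convert one_mem_ratSpan w using 1
    ext k
    simp
  · exact Submodule.subset_span (Or.inr ⟨i, a, ha, h, rfl⟩)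

lemma aeval_mem_ratSpan (f : Polynomial ℚ) (w : ℕ) :
    (fun k : ℕ => Polynomial.aeval ((k : ℝ) + 1) f) ∈ ratSpan w := by
  have e : (fun k : ℕ => Polynomial.aeval ((k : ℝ) + 1) f) =
      ∑ i ∈ Finset.range (f.natDegree + 1), f.coeff i • fun k : ℕ => ((k : ℝ) + 1) ^ i := by
    ext k
    simp [Polynomial.aeval_eq_sum_range]
  rw [e]
  exact sum_mem fun i _ => Submodule.smul_mem _ _ (pow_mem_ratSpan i w)

/-- Partial fractions. -/
lemma aeval_mul_prod_mem_ratSpan (f : Polynomial ℚ) (n w : ℕ) (e : ℕ → ℕ) (he : ∀ i, e i ≤ w) :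
    (fun k : ℕ => Polynomial.aeval ((k : ℝ) + 1) f *
      ∏ i ∈ Finset.range n, (1 / ((k : ℝ) + 1 + i)) ^ e i) ∈ ratSpan w := by
  classical
  -- Partial fractions are taken in the ring of sequences, which is not a field but where every `X +
  -- i`, evaluated at `k + 1`, is invertible.
  let φ : Polynomial ℚ →+* (ℕ → ℝ) :=
    (Polynomial.aeval (fun k : ℕ => (k : ℝ) + 1)).toRingHom
  let _ : Algebra (Polynomial ℚ) (ℕ → ℝ) := φ.toAlgebra
  have hφ : ∀ (g : Polynomial ℚ) (k : ℕ),
      algebraMap (Polynomial ℚ) (ℕ → ℝ) g k = Polynomial.aeval ((k : ℝ) + 1) g := by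
    intro g k
    have := Polynomial.aeval_algHom_apply (Pi.evalAlgHom ℚ (fun _ : ℕ => ℝ) k)
      (fun k : ℕ => (k : ℝ) + 1) g
    exact this.symm
  obtain ⟨q, r, hr, h⟩ := Polynomial.mul_prod_pow_inverse_eq_quo_add_sum_rem_mul_pow_inverse
    (K := ℕ → ℝ) (s := Finset.range n) f (g := fun i : ℕ => Polynomial.X + Polynomial.C (i : ℚ))
    (fun i _ => Polynomial.monic_X_add_C _) (fun i _ j _ hij => by
      have := Polynomial.pairwise_coprime_X_sub_C (K := ℚ) (s := fun i : ℕ => -(i : ℚ))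
        (fun a b hab => by simpa using hab) hij
      simpa [Function.onFun] using this)
    e (gi := fun i k => 1 / ((k : ℝ) + 1 + i)) (fun i _ => by
      ext k
      have : (k : ℝ) + 1 + i ≠ 0 := by positivity
      simp only [Pi.mul_apply, hφ, Pi.one_apply]
      simp [this])
  have h' : (fun k : ℕ => Polynomial.aeval ((k : ℝ) + 1) f *
      ∏ i ∈ Finset.range n, (1 / ((k : ℝ) + 1 + i)) ^ e i) =
      algebraMap (Polynomial ℚ) (ℕ → ℝ) f *
        ∏ i ∈ Finset.range n, (fun k : ℕ => 1 / ((k : ℝ) + 1 + i)) ^ e i := by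
    ext k
    simp [hφ]
  rw [h', h]
  refine add_mem ?_ (sum_mem fun i hi => sum_mem fun j _ => ?_)
  · convert aeval_mem_ratSpan q w using 1
    ext k
    exact hφ q k
  -- The remainders modulo the linear `X + i` are constants.
  · have hdeg := hr i hi j
    rw [Polynomial.degree_X_add_C] at hdeg
    rw [Polynomial.eq_C_of_degree_le_zero (Nat.WithBot.lt_one_iff_le_zero.1 hdeg)]
    convert Submodule.smul_mem _ ((r i j).coeff 0)
      (inv_pow_mem_ratSpan i (show j.1 + 1 ≤ w by have := j.2; have := he i; omega)) using 1
    ext k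
    simp only [Pi.mul_apply, Pi.pow_apply, Pi.smul_apply, hφ, Polynomial.aeval_C]
    simp [Rat.smul_def]

lemma prod_range_pow_single (x : ℕ → ℝ) {i n : ℕ} (a : ℕ) (hi : i < n) :
    ∏ l ∈ Finset.range n, x l ^ (Pi.single i a : ℕ → ℕ) l = x i ^ a := by
  rw [Finset.prod_eq_single i]
  · simp
  · intro l _ hl
    simp [Pi.single_eq_of_ne hl]
  · intro h
    exact absurd (Finset.mem_range.2 hi) h

/-- Pole orders add only at a common pole, so partial fractions of a product stay within `a + b`.
Polynomial factors cost no weight. -/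
lemma ratSpan_mul {a b : ℕ} {f g : ℕ → ℝ} (hf : f ∈ ratSpan a) (hg : g ∈ ratSpan b) :
    f * g ∈ ratSpan (a + b) := by
  have single_le : ∀ i c l : ℕ, (Pi.single i c : ℕ → ℕ) l ≤ c := fun i c l => by
    rw [Pi.single_apply]
    split_ifs <;> omega
  have pow_inv : ∀ m i c w : ℕ, c ≤ w →
      (fun k : ℕ => ((k : ℝ) + 1) ^ m * (1 / ((k : ℝ) + 1 + i) ^ c)) ∈ ratSpan w := by
    intro m i c w hc
    convert aeval_mul_prod_mem_ratSpan (Polynomial.X ^ m) (i + 1) w (Pi.single i c)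
      (fun l => (single_le i c l).trans hc) using 1
    ext k
    rw [prod_range_pow_single (fun l : ℕ => 1 / ((k : ℝ) + 1 + l)) c (Nat.lt_succ_self i)]
    simp
  induction hf using Submodule.span_induction with
  | mem f hf =>
    induction hg using Submodule.span_induction with
    | mem g hg =>
      rcases hf with ⟨m, rfl⟩ | ⟨i, c, hc, hc', rfl⟩ <;>
        rcases hg with ⟨m', rfl⟩ | ⟨i', c', hd, hd', rfl⟩
      · convert pow_mem_ratSpan (m + m') (a + b) using 1
        ext k
        simp [pow_add]
      · exact pow_inv m i' c' _ (by omega)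
      · rw [mul_comm]
        exact pow_inv m' i c _ (by omega)
      · convert aeval_mul_prod_mem_ratSpan 1 (max i i' + 1) (a + b)
          (Pi.single i c + Pi.single i' c') (fun l => add_le_add
            ((single_le i c l).trans hc') ((single_le i' c' l).trans hd')) using 1
        ext k
        simp only [Pi.add_apply, pow_add, Finset.prod_mul_distrib]
        rw [prod_range_pow_single (fun l : ℕ => 1 / ((k : ℝ) + 1 + l)) c (by omega),
          prod_range_pow_single (fun l : ℕ => 1 / ((k : ℝ) + 1 + l)) c' (by omega)]
        simp
    | zero => simp
    | add g g' _ _ hg hg' => rw [mul_add]; exact add_mem hg hg'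
    | smul q g _ hg => rw [mul_smul_comm]; exact Submodule.smul_mem _ _ hg
  | zero => simp
  | add f f' _ _ hf hf' => rw [add_mul]; exact add_mem hf hf'
  | smul q f _ hf => rw [smul_mul_assoc]; exact Submodule.smul_mem _ _ hf

lemma ascPochhammer_eval_eq_prod (n : ℕ) (x : ℝ) :
    (ascPochhammer ℝ n).eval x = ∏ i ∈ Finset.range n, (x + i) := by
  induction n with
  | zero => simp
  | succ n ih => rw [ascPochhammer_succ_eval, ih, Finset.prod_range_succ]

lemma pow_div_ascPochhammer_mem_ratSpan (m n A : ℕ) :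
    (fun k : ℕ => ((k : ℝ) + 1) ^ m / (ascPochhammer ℝ (n + 1)).eval ((k : ℝ) + 1) ^ A)
      ∈ ratSpan A := by
  convert aeval_mul_prod_mem_ratSpan (Polynomial.X ^ m) (n + 1) A (fun _ => A)
    (fun _ => le_rfl) using 1
  ext k
  rw [ascPochhammer_eval_eq_prod, Finset.prod_pow, Finset.prod_div_distrib]
  simp [div_eq_mul_inv]

/-! ### Indefinite summation at the finite level -/

/-- The span of the products of a multiple harmonic sum and a rational function, of depth at most
`p` and total weight at most `w`. -/
def mhsSpan (p w : ℕ) : Submodule ℚ (ℕ → ℝ) :=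
  Submodule.span ℚ {f | ∃ (s : List ℕ) (a : ℕ), ∃ r ∈ ratSpan a, (∀ x ∈ s, 1 ≤ x) ∧ s.length ≤ p ∧
    a + s.sum ≤ w ∧ f = r * fun N => mhs s (N + 1)}

lemma mhsSpan_mono {p p' w w' : ℕ} (hp : p ≤ p') (hw : w ≤ w') : mhsSpan p w ≤ mhsSpan p' w' :=
  Submodule.span_mono fun _ ⟨s, a, r, hr, h1, h2, h3, h4⟩ =>
    ⟨s, a, r, hr, h1, h2.trans hp, h3.trans hw, h4⟩

lemma mul_mhs_mem_mhsSpan {s : List ℕ} {a p w : ℕ} {r : ℕ → ℝ} (hr : r ∈ ratSpan a)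
    (hs : ∀ x ∈ s, 1 ≤ x) (hp : s.length ≤ p) (hw : a + s.sum ≤ w) :
    (r * fun N => mhs s (N + 1)) ∈ mhsSpan p w :=
  Submodule.subset_span ⟨s, a, r, hr, hs, hp, hw, rfl⟩

lemma mhs_succ_mem_mhsSpan {s : List ℕ} {p w : ℕ} (hs : ∀ x ∈ s, 1 ≤ x) (hp : s.length ≤ p)
    (hw : s.sum ≤ w) : (fun N => mhs s (N + 1)) ∈ mhsSpan p w := by
  have := mul_mhs_mem_mhsSpan (one_mem_ratSpan 0) hs hp (by omega : 0 + s.sum ≤ w)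
  rwa [one_mul] at this

lemma mul_mem_mhsSpan {a p w : ℕ} {r f : ℕ → ℝ} (hr : r ∈ ratSpan a) (hf : f ∈ mhsSpan p w) :
    r * f ∈ mhsSpan p (a + w) := by
  refine Submodule.span_le (p := (mhsSpan p (a + w)).comap (LinearMap.mulLeft ℚ r)).2 ?_ hf
  rintro _ ⟨s, b, r', hr', hs, hp, hw, rfl⟩
  simp only [SetLike.mem_coe, Submodule.mem_comap, LinearMap.mulLeft_apply]
  rw [← mul_assoc]
  exact mul_mhs_mem_mhsSpan (ratSpan_mul hr hr') hs hp (by omega)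

lemma mhs_mem_mhsSpan {s : List ℕ} (hs : ∀ x ∈ s, 1 ≤ x) : mhs s ∈ mhsSpan s.length s.sum := by
  induction s with
  | nil => exact mhs_succ_mem_mhsSpan hs le_rfl le_rfl
  | cons a s ih =>
    have h1 := mhs_succ_mem_mhsSpan hs le_rfl le_rfl
    simp only [List.mem_cons, forall_eq_or_imp] at hs
    have h2 := mhsSpan_mono (Nat.le_succ s.length) le_rfl
      (mul_mem_mhsSpan (inv_pow_mem_ratSpan 0 (le_refl a)) (ih hs.2))
    convert sub_mem h1 h2 using 1
    ext N
    simp [mhs_cons_succ]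

/-- Faulhaber's formula: the sum is again a polynomial. -/
lemma psum_pow_mem_ratSpan (m w : ℕ) : psum (fun k : ℕ => ((k : ℝ) + 1) ^ m) ∈ ratSpan w := by
  have e : psum (fun k : ℕ => ((k : ℝ) + 1) ^ m) =
      ∑ i ∈ Finset.range (m + 1), (bernoulli' i * ((m + 1).choose i) / (m + 1) : ℚ) •
        fun k : ℕ => ((k : ℝ) + 1) ^ (m + 1 - i) := by
    ext N
    have h := congrArg (fun x : ℚ => (x : ℝ)) (sum_Ico_pow (N + 1) m)
    have h1 := sum_Icc_one_eq_sum_range (fun a => (a : ℝ) ^ m) (N + 1)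
    push_cast at h h1
    rw [psum_apply, ← h1]
    refine h.trans ?_
    simp only [Finset.sum_apply, Pi.smul_apply, Rat.smul_def]
    refine Finset.sum_congr rfl fun i _ => ?_
    push_cast
    ring
  rw [e]
  exact sum_mem fun i _ => Submodule.smul_mem _ _ (pow_mem_ratSpan _ w)

/-- Summation by parts. -/
lemma psum_mul_eq (b h : ℕ → ℝ) :
    psum (b * fun k => h (k + 1)) =
      (psum b * fun k => h (k + 1)) - psum ((psum b - b) * fun k => h (k + 1) - h k) := by
  ext N
  induction N with
  | zero => simp [psum_apply]
  | succ N ih =>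
    simp only [psum_apply, Pi.sub_apply, Pi.mul_apply] at ih ⊢
    simp only [Finset.sum_range_succ _ (N + 1)]
    linear_combination ih

/-- Trades the shifted `v` for `v`, up to boundary terms and a sum against the increment of `h`; it
moves a pole from `i + 1` to `i`. -/
lemma psum_mul_shift_eq (v h : ℕ → ℝ) (N : ℕ) :
    psum ((fun k => v (k + 1)) * fun k => h (k + 1)) N =
      psum (v * fun k => h (k + 1)) N + v (N + 1) * h (N + 1) - v 0 * h 0
        - psum (v * fun k => h (k + 1) - h k) N := by
  simp only [psum_apply, Pi.mul_apply]
  induction N with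
  | zero => simp; ring
  | succ N ih =>
    rw [Finset.sum_range_succ, ih, Finset.sum_range_succ _ (N + 1), Finset.sum_range_succ _ (N + 1)]
    ring

/-- Powers are summed by parts, poles with `i = 0` give `mhs (c :: s)` by its recursion, and other
poles are shifted down to `i = 0`. Each case leaves a sum against the increment of `mhs s`, which
`H` supplies. -/
lemma psum_mul_mhs_mem {s : List ℕ} (hs : ∀ x ∈ s, 1 ≤ x) {p w : ℕ} (hp : s.length ≤ p)
    (H : ∀ (a : ℕ), ∀ r ∈ ratSpan a, a + s.sum ≤ w →
      psum (r * fun k => mhs s (k + 1) - mhs s k) ∈ mhsSpan (p + 1) w)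
    {a : ℕ} {r : ℕ → ℝ} (hr : r ∈ ratSpan a) (ha : a + s.sum ≤ w) :
    psum (r * fun k => mhs s (k + 1)) ∈ mhsSpan (p + 1) w := by
  induction hr using Submodule.span_induction with
  | mem r hr =>
    rcases hr with ⟨m, rfl⟩ | ⟨i, c, hc, hc', rfl⟩
    · rw [psum_mul_eq]
      have h0 := psum_pow_mem_ratSpan m 0
      exact sub_mem (mul_mhs_mem_mhsSpan h0 hs (by omega) (by omega))
        (H 0 _ (sub_mem h0 (pow_mem_ratSpan m 0)) (by omega))
    · induction i with
      | zero =>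
        have h1 : (fun N => mhs (c :: s) (N + 1)) ∈ mhsSpan (p + 1) w :=
          mhs_succ_mem_mhsSpan (by simpa using ⟨hc, hs⟩) (by simpa using hp) (by simp; omega)
        convert add_mem h1 (H a _ (inv_pow_mem_ratSpan 0 hc') ha) using 1
        ext N
        simp only [Pi.add_apply, psum_apply, Pi.mul_apply, mhs, ← Finset.sum_add_distrib]
        refine Finset.sum_congr rfl fun k _ => ?_
        push_cast
        ring
      | succ i ih =>
        have h1 : (fun k : ℕ => 1 / ((k : ℝ) + 1 + (i + 1 : ℕ)) ^ c) * (fun k => mhs s (k + 1)) ∈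
            mhsSpan (p + 1) w :=
          mul_mhs_mem_mhsSpan (inv_pow_mem_ratSpan (i + 1) hc') hs (by omega) ha
        -- The boundary value is 1 for the empty index and 0 otherwise, so that boundary term is a
        -- rational constant.
        have h2 : ∃ q : ℚ, (q : ℝ) = mhs s 0 := by
          cases s
          exacts [⟨1, by simp [mhs]⟩, ⟨0, by simp [mhs]⟩]
        obtain ⟨q, hq⟩ := h2
        have h3 : (fun N => mhs [] (N + 1)) ∈ mhsSpan (p + 1) w :=
          mhs_succ_mem_mhsSpan (by simp) (by simp) (by simp)
        convert sub_mem (sub_mem (add_mem ih h1)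
          (Submodule.smul_mem _ (1 / (0 + 1 + i : ℚ) ^ c * q) h3))
          (H a _ (inv_pow_mem_ratSpan i hc') ha) using 1
        ext N
        have := psum_mul_shift_eq (fun k : ℕ => 1 / ((k : ℝ) + 1 + i) ^ c) (mhs s) N
        have e : (fun k : ℕ => 1 / ((k : ℝ) + 1 + (i + 1 : ℕ)) ^ c) =
            fun k : ℕ => 1 / (((k + 1 : ℕ) : ℝ) + 1 + i) ^ c := by
          ext k
          push_cast
          ring
        rw [e, this]
        simp only [Pi.add_apply, Pi.sub_apply, Pi.mul_apply, Pi.smul_apply, Rat.smul_def, mhs]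
        push_cast
        rw [hq]
        ring
  | zero => simp
  | add f g _ _ hf hg => rw [add_mul, map_add]; exact add_mem hf hg
  | smul q f _ hf => rw [smul_mul_assoc, map_smul]; exact Submodule.smul_mem _ _ hf

/-- Induction on depth: the increment of `mhs (b :: s)` is `mhs s k / (k + 1) ^ b`, which has one
unit of depth less, while `b` passes to the rational factor and the total weight is unchanged. -/
theorem psum_mem_mhsSpan {p w : ℕ} {f : ℕ → ℝ} (hf : f ∈ mhsSpan p w) :
    psum f ∈ mhsSpan (p + 1) w := by
  induction p generalizing w f with
  | zero =>
    refine Submodule.span_le (p := (mhsSpan 1 w).comap psum).2 ?_ hf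
    rintro _ ⟨s, a, r, hr, hs, hp, hw, rfl⟩
    refine psum_mul_mhs_mem hs hp (fun a r _ _ => ?_) hr hw
    obtain rfl := List.length_eq_zero_iff.1 (Nat.le_zero.1 hp)
    have e : (r * fun k => mhs [] (k + 1) - mhs [] k) = 0 := by ext k; simp [mhs]
    rw [e, map_zero]
    exact zero_mem _
  | succ p ih =>
    refine Submodule.span_le (p := (mhsSpan (p + 1 + 1) w).comap psum).2 ?_ hf
    rintro _ ⟨s, a, r, hr, hs, hp, hw, rfl⟩
    refine psum_mul_mhs_mem hs hp (fun a r hr ha => ?_) hr hw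
    cases s with
    | nil =>
      have e : (r * fun k => mhs [] (k + 1) - mhs [] k) = 0 := by ext k; simp [mhs]
      rw [e, map_zero]
      exact zero_mem _
    | cons b s =>
      simp only [List.mem_cons, forall_eq_or_imp, List.length_cons, List.sum_cons] at hs hp ha
      have h1 := mul_mem_mhsSpan hr
        (mul_mem_mhsSpan (inv_pow_mem_ratSpan 0 (le_refl b)) (mhs_mem_mhsSpan hs.2))
      have h2 := mhsSpan_mono (Nat.le_succ (p + 1)) le_rfl
        (ih (mhsSpan_mono (show s.length ≤ p by omega) ha h1))
      convert h2 using 3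
      ext k
      simp [mhs_cons_succ]

/-! ### Nested sums and the partial sums of the series -/

lemma mem_chainsUpTo {p N : ℕ} {k : Fin p → ℕ} :
    k ∈ chainsUpTo p N ↔ (∀ j, 1 ≤ k j ∧ k j ≤ N) ∧ Antitone k := by
  simp [chainsUpTo]

lemma antitone_cons {p a : ℕ} {t : Fin p → ℕ} :
    Antitone (Fin.cons a t : Fin (p + 1) → ℕ) ↔ (∀ j, t j ≤ a) ∧ Antitone t := by
  refine ⟨fun h => ⟨fun j => ?_, fun i j hij => ?_⟩, fun h i j => ?_⟩
  · simpa using h (Fin.zero_le j.succ)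
  · simpa using h (Fin.succ_le_succ_iff.2 hij)
  · refine Fin.cases ?_ (fun i => ?_) i <;> refine Fin.cases ?_ (fun j => ?_) j
    · simp
    · simpa using h.1 j
    · simp
    · simpa using fun hij => h.2 hij

lemma sum_chainsUpTo_succ (p N : ℕ) (F : (Fin (p + 1) → ℕ) → ℝ) :
    ∑ k ∈ chainsUpTo (p + 1) N, F k =
      ∑ a ∈ Finset.range N, ∑ t ∈ chainsUpTo p (a + 1), F (Fin.cons (a + 1) t) := by
  rw [← sum_Icc_one_eq_sum_range (fun a => ∑ t ∈ chainsUpTo p a, F (Fin.cons a t)) N,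
    Finset.sum_sigma']
  refine Finset.sum_nbij' (fun k => ⟨k 0, Fin.tail k⟩) (fun x => Fin.cons x.1 x.2) ?_ ?_ ?_ ?_ ?_
  · intro k hk
    rw [← Fin.cons_self_tail k] at hk
    simp only [mem_chainsUpTo, antitone_cons, Fin.forall_fin_succ, Fin.cons_zero,
      Fin.cons_succ] at hk
    simp only [Finset.mem_sigma, Finset.mem_Icc, mem_chainsUpTo]
    exact ⟨hk.1.1, fun j => ⟨(hk.1.2 j).1, hk.2.1 j⟩, hk.2.2⟩
  · rintro ⟨a, t⟩ h
    simp only [Finset.mem_sigma, Finset.mem_Icc, mem_chainsUpTo] at h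
    simp only [mem_chainsUpTo, antitone_cons, Fin.forall_fin_succ, Fin.cons_zero, Fin.cons_succ]
    exact ⟨⟨h.1, fun j => by have := h.2.1 j; omega⟩, fun j => (h.2.1 j).2, h.2.2⟩
  · intro k _
    exact Fin.cons_self_tail k
  · rintro ⟨a, t⟩ _
    simp
  · intro k _
    rw [Fin.cons_self_tail]

/-- Each variable contributes its pole order to the weight through the product, and one unit of
depth through the summation. -/
lemma sum_chainsUpTo_prod_mem_mhsSpan {p : ℕ} (R : Fin p → ℕ → ℝ) (A : Fin p → ℕ)
    (hR : ∀ j, (fun k => R j (k + 1)) ∈ ratSpan (A j)) :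
    (fun N => ∑ k ∈ chainsUpTo p (N + 1), ∏ j, R j (k j)) ∈ mhsSpan p (∑ j, A j) := by
  induction p with
  | zero =>
    have e : (fun N => ∑ k ∈ chainsUpTo 0 (N + 1), ∏ j, R j (k j)) = fun N => mhs [] (N + 1) := by
      ext N
      have : chainsUpTo 0 (N + 1) = {default} := by
        ext k
        simp [mem_chainsUpTo, Subsingleton.elim k default, Subsingleton.antitone]
      rw [this]
      simp [mhs]
    rw [e]
    exact mhs_succ_mem_mhsSpan (by simp) (by simp) (by simp)
  | succ p ih =>
    have h := psum_mem_mhsSpan (mul_mem_mhsSpan (hR 0)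
      (ih (fun j => R j.succ) (fun j => A j.succ) fun j => hR j.succ))
    rw [Fin.sum_univ_succ]
    convert h using 1
    ext N
    rw [psum_apply, sum_chainsUpTo_succ]
    refine Finset.sum_congr rfl fun a _ => ?_
    rw [Pi.mul_apply, Finset.mul_sum]
    refine Finset.sum_congr rfl fun t _ => ?_
    simp [Fin.prod_univ_succ]

theorem sum_hypergeomTerm_mem_mhsSpan {p : ℕ} (P : MvPolynomial (Fin p) ℚ) (n A : Fin p → ℕ) :
    (fun N => ∑ k ∈ chainsUpTo p (N + 1), hypergeomTerm P n A k) ∈ mhsSpan p (∑ j, A j) := by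
  have e : (fun N => ∑ k ∈ chainsUpTo p (N + 1), hypergeomTerm P n A k) =
      -- Monomial by monomial, the summand factors into functions of one variable.
      ∑ d ∈ P.support, P.coeff d • fun N => ∑ k ∈ chainsUpTo p (N + 1),
        ∏ j, ((k j : ℝ) ^ d j / (ascPochhammer ℝ (n j + 1)).eval (k j : ℝ) ^ A j) := by
    ext N
    simp only [Finset.sum_apply, Pi.smul_apply, Finset.smul_sum]
    rw [Finset.sum_comm]
    refine Finset.sum_congr rfl fun k _ => ?_
    rw [hypergeomTerm, MvPolynomial.aeval_def, MvPolynomial.eval₂_eq', Finset.sum_div]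
    refine Finset.sum_congr rfl fun d _ => ?_
    rw [Finset.prod_div_distrib, Rat.smul_def, mul_div_assoc]
    rfl
  rw [e]
  refine sum_mem fun d _ => Submodule.smul_mem _ _ ?_
  refine sum_chainsUpTo_prod_mem_mhsSpan
    (fun j k => (k : ℝ) ^ d j / (ascPochhammer ℝ (n j + 1)).eval (k : ℝ) ^ A j) A fun j => ?_
  simpa using pow_div_ascPochhammer_mem_ratSpan (d j) (n j) (A j)

/-! ### Expansion of the partial sums and conclusion -/

lemma exists_mem_AsympExp_of_mem_ratSpan {w : ℕ} {r : ℕ → ℝ} (hr : r ∈ ratSpan w) :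
    ∃ d, r ∈ AsympExp 1 d := by
  induction hr using Submodule.span_induction with
  | mem r hr =>
    rcases hr with ⟨m, rfl⟩ | ⟨i, a, -, -, rfl⟩
    · exact ⟨m, by simpa using zpow_mem_AsympExp m⟩
    · refine ⟨_, AsympExp_congr (AsympExp_pow (inv_mem_AsympExp i) a)
        (Eventually.of_forall fun k => ?_)⟩
      simp
  | zero => exact ⟨0, zero_mem _⟩
  | add f g _ _ hf hg =>
    obtain ⟨d, hf⟩ := hf
    obtain ⟨d', hg⟩ := hg
    exact ⟨max d d', add_mem (AsympExp_mono le_rfl (le_max_left _ _) hf)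
      (AsympExp_mono le_rfl (le_max_right _ _) hg)⟩
  | smul q f _ hf =>
    obtain ⟨d, hf⟩ := hf
    exact ⟨d, Submodule.smul_mem _ _ hf⟩

lemma exists_mem_AsympExp_of_mem_mhsSpan {p w : ℕ} {f : ℕ → ℝ} (hf : f ∈ mhsSpan p w) :
    ∃ d, f ∈ AsympExp (multiZetaSpan p w) d := by
  induction hf using Submodule.span_induction with
  | mem f hf =>
    obtain ⟨s, a, r, hr, hs, hp, hw, rfl⟩ := hf
    obtain ⟨d, hd⟩ := exists_mem_AsympExp_of_mem_ratSpan hr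
    rw [mul_comm]
    exact ⟨_, AsympExp_mul (AsympExp_mono (multiZetaSpan_mono hp (by omega)) le_rfl
      (mhs_mem_AsympExp s hs)) hd⟩
  | zero => exact ⟨0, zero_mem _⟩
  | add f g _ _ hf hg =>
    obtain ⟨d, hf⟩ := hf
    obtain ⟨d', hg⟩ := hg
    exact ⟨max d d', add_mem (AsympExp_mono le_rfl (le_max_left _ _) hf)
      (AsympExp_mono le_rfl (le_max_right _ _) hg)⟩
  | smul q f _ hf =>
    obtain ⟨d, hf⟩ := hf
    exact ⟨d, Submodule.smul_mem _ _ hf⟩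

end

theorem mainTheorem1 (p : ℕ) (hp : 1 ≤ p) (P : MvPolynomial (Fin p) ℚ) (n A : Fin p → ℕ)
    (hA : ∀ j, 1 ≤ A j) (S : ℝ) (hS : HasMultipleSum (hypergeomTerm P n A) S) :
    S ∈ multiZetaSpan p (∑ j, A j) := by
  obtain ⟨d, hd⟩ := exists_mem_AsympExp_of_mem_mhsSpan (sum_hypergeomTerm_mem_mhsSpan P n A)
  exact mem_of_tendsto_of_mem_AsympExp hd ((tendsto_add_atTop_iff_nat 1).2 hS)
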